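/- **Notation.** For a finite-dimensional real inner product space $V$ let $\mathrm{Alt}^{k,\ell}(V)=\mathrm{Alt}^k(V)\otimes\mathrm{Alt}^\ell(V)$ (alternating $k$-forms with values in alternating $\ell$-forms), with the Frobenius inner product. Define $\mathcal S^{k,\ell}:\mathrm{Alt}^{k,\ell}\to\mathrm{Alt}^{k+1,\ell-1}$ and $\mathcal S_\dagger^{k,\ell}:\mathrm{Alt}^{k,\ell}\to\mathrm{Alt}^{k-1,\ell+1}$ by $$\mathcal S^{k,\ell}\omega(v_1,\dots,v_{k+1})(u_1,\dots,u_{\ell-1})=\sum_{j=1}^{k+1}(-1)^{j+1}\omega(v_1,\dots,\widehat{v_j},\dots,v_{k+1})(v_j,u_1,\dots,u_{\ell-1}),$$ $$\mathcal S_\dagger^{k,\ell}\omega(v_1,\dots,v_{k-1})(u_1,\dots,u_{\ell+1})=\sum_{j=1}^{\ell+1}(-1)^{j+1}\omega(u_j,v_1,\dots,v_{k-1})(u_1,\dots,\widehat{u_j},\dots,u_{\ell+1}),$$ and let $\mathcal S_{[q]}^{k,\ell}:\mathrm{Alt}^{k,\ell}\to\mathrm{Alt}^{k+q,\ell-q}$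 and $\mathcal S_{\dagger,[q]}^{k,\ell}:\mathrm{Alt}^{k,\ell}\to\mathrm{Alt}^{k-q,\ell+q}$ be their $q$-fold iterates starting at degree $(k,\ell)$. Put $\mathbb W^{k,\ell}_{[q]}(V)=\ker\mathcal S^{k,\ell}_{\dagger,[q]}$. For a simplex $\sigma\subset\mathbb R^n$ with tangent space $T_\sigma$ write $\mathrm{Alt}^{k,\ell}(\sigma)=\mathrm{Alt}^{k,\ell}(T_\sigma)$, let $\iota_\sigma^*\iota_\sigma^*$ be the restriction of all arguments of a form-valued form to $T_\sigma$, and let $\langle\cdot,\cdot\rangle_\sigma$ be the $L^2(\sigma)$ inner product induced by the Frobenius inner product. With $\kappa$ the Koszul operator in the first factor (contraction of the first argument with the position vector), set $$\mathcal P^-\mathrm{Alt}^{k,\ell}(\sigma)=\mathrm{Alt}^{k,\ell}(\sigma)+\kappa\,\mathrm{Alt}^{k+1,\ell}(\sigma),$$ $$\mathcal B^-\mathrm{Alt}^{k,\ell}(\sigma)=\{\omega\in\mathcal P^-\mathrm{Alt}^{k,\ell}(\sigma):\iota_F^*\iota_F^*\omega=0\text{ for all proper subsimplices }F\text{ of }\sigma\},$$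 $$\mathcal B^-\mathbb W^{k,\ell}_{[q]}(\sigma)=\{\omega\in\mathcal B^-\mathrm{Alt}^{k,\ell}(\sigma):\mathcal S_{\dagger,[q]}\,\omega=0\}.$$ **Theorem.** Let $n,k,\ell,p$ be nonnegative integers with $p\le k\le\ell\le n-p$. For every simplex $\sigma$ put $$B(\sigma)=\bigoplus_{s=0}^{p-1}\mathcal S_{[s]}^{k-s,\ell+s}\,\mathcal S_{\dagger,[\ell-k+2s]}^{\ell+s,k-s}\,\mathcal B^-\mathbb W^{\ell+s,k-s}_{[\ell-k+2s+1]}(\sigma).$$ 1. Let $K\subset\mathbb R^n$ be an $n$-simplex. For every subsimplex $\sigma$ of $K$ the sum defining $B(\sigma)$ is direct, and the degrees of freedom $$\langle\iota_\sigma^*\iota_\sigma^*\omega,b\rangle_\sigma,\qquad b\in B(\sigma),\ \sigma\text{ a subsimplex of }K\text{ of any dimension }0,\dots,n,$$ are unisolvent for the space $\mathbb W^{k,\ell}_{[p]}(K)=\mathbb W^{k,\ell}_{[p]}(\mathbb R^n)$ of constant form-valued forms: for any choice of linear functionals $L_\sigma$ on $B(\sigma)$ there is exactly one $\omega\in\mathbb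 W^{k,\ell}_{[p]}(K)$ with $\langle\iota_\sigma^*\iota_\sigma^*\omega,b\rangle_\sigma=L_\sigma(b)$ for all $\sigma$ and all $b\in B(\sigma)$. 2. The resulting piecewise constant finite element space is $\iota^*\iota^*$-conforming: let $\mathcal T$ be a geometric simplicial complex in $\mathbb R^n$ and let $u$ assign to each $n$-simplex $K$ of $\mathcal T$ a constant form $u_K\in\mathbb W^{k,\ell}_{[p]}(K)$ such that for each $\sigma\in\mathcal T$ and each $b\in B(\sigma)$ the value $\langle\iota_\sigma^*\iota_\sigma^*u_K,b\rangle_\sigma$ is the same for all $n$-simplices $K\supseteq\sigma$ of $\mathcal T$. Then $\iota_\sigma^*\iota_\sigma^*u_K=\iota_\sigma^*\iota_\sigma^*u_{K'}$ for every simplex $\sigma\in\mathcal T$ of any dimension and all $n$-simplices $K,K'\supseteq\sigma$ of $\mathcal T$. -/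

import Mathlib

open MeasureTheory

noncomputable section

namespace FormValued

/-! ### Algebraic form-valued forms -/

section Algebra

variable (V : Type*) [AddCommGroup V] [Module ℝ V]

/-- `Alt^{k,ℓ}(V) = Alt^k(V) ⊗ Alt^ℓ(V)`: alternating `k`-forms on `V` with values in the
alternating `ℓ`-forms on `V`. For finite-dimensional `V` this is the tensor product, where `α ⊗ β`
is the map `v ↦ α v • β`. -/
abbrev Form (k ℓ : ℕ) : Type _ := V [⋀^Fin k]→ₗ[ℝ] (V [⋀^Fin ℓ]→ₗ[ℝ] ℝ)

variable {V}

/-- `x, ω ↦ ω(·)(x, ·)`: insertion of a vector in the first argument of the `ℓ`-form part. -/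
def insertSnd {k ℓ : ℕ} (ω : Form V k (ℓ + 1)) : V →ₗ[ℝ] Form V k ℓ where
  toFun x := (AlternatingMap.curryLeftLinearMap.flip x).compAlternatingMap ω
  map_add' x y := by ext; simp
  map_smul' c x := by ext; simp

/-- `ω(x, v)(u)` as an alternating map of `v` with values in the linear maps of `x`. -/
def insertFst {k ℓ : ℕ} (ω : Form V (k + 1) ℓ) :
    V [⋀^Fin k]→ₗ[ℝ] (V →ₗ[ℝ] V [⋀^Fin ℓ]→ₗ[ℝ] ℝ) where
  toFun v :=
    { toFun := fun x => ω.curryLeft x v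
      map_add' := fun x y => by rw [map_add]; rfl
      map_smul' := fun c x => by rw [map_smul]; rfl }
  map_update_add' v i x y := by
    ext z : 1
    exact (ω.curryLeft z).map_update_add v i x y
  map_update_smul' v i c x := by
    ext z : 1
    exact (ω.curryLeft z).map_update_smul v i c x
  map_eq_zero_of_eq' v i j h hij := by
    ext z : 1
    exact (ω.curryLeft z).map_eq_zero_of_eq v h hij

variable (V)

/-- The connecting map `𝒮^{k,ℓ} : Alt^{k,ℓ} → Alt^{k+1,ℓ-1}` (zero for `ℓ = 0`). -/
def connS (k : ℕ) : (ℓ : ℕ) → Form V k ℓ →ₗ[ℝ] Form V (k + 1) (ℓ - 1)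
  | 0 => 0
  | ℓ + 1 =>
    { toFun := fun ω => AlternatingMap.alternatizeUncurryFin (insertSnd ω)
      map_add' := fun ω η => by
        rw [← AlternatingMap.alternatizeUncurryFin_add]; congr 1
      map_smul' := fun c ω => by
        rw [RingHom.id_apply, ← AlternatingMap.alternatizeUncurryFin_smul]
        congr 1 }

/-- The connecting map `𝒮_†^{k,ℓ} : Alt^{k,ℓ} → Alt^{k-1,ℓ+1}` (zero for `k = 0`). -/
def connSDag : (k ℓ : ℕ) → Form V k ℓ →ₗ[ℝ] Form V (k - 1) (ℓ + 1)
  | 0, _ => 0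
  | k + 1, ℓ =>
    { toFun := fun ω =>
        AlternatingMap.alternatizeUncurryFinLM.compAlternatingMap (insertFst ω)
      map_add' := fun ω η => by
        ext v u
        simp [insertFst, AlternatingMap.alternatizeUncurryFin_apply, Finset.sum_add_distrib]
      map_smul' := fun c ω => by
        ext v u
        simp [insertFst, AlternatingMap.alternatizeUncurryFin_apply, Finset.mul_sum,
          mul_left_comm] }

variable {V}

/-- The defining formula of `𝒮`, with the indices `j` counted from `0`. -/
theorem connS_apply (k ℓ : ℕ) (ω : Form V k (ℓ + 1)) (v : Fin (k + 1) → V) (u : Fin ℓ → V) :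
    connS V k (ℓ + 1) ω v u =
      ∑ j : Fin (k + 1), (-1 : ℝ) ^ (j : ℕ) * ω (j.removeNth v) (Matrix.vecCons (v j) u) := by
  let ev : (V [⋀^Fin ℓ]→ₗ[ℝ] ℝ) →+ ℝ :=
    { toFun := fun β => β u, map_zero' := rfl, map_add' := fun _ _ => rfl }
  change ev (connS V k (ℓ + 1) ω v) = _
  simp only [connS, LinearMap.coe_mk, AddHom.coe_mk, AlternatingMap.alternatizeUncurryFin_apply,
    map_sum]
  refine Finset.sum_congr rfl fun j _ => ?_
  rcases Nat.even_or_odd (j : ℕ) with h | h <;> simp [h.neg_one_pow, insertSnd, ev]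

/-- The defining formula of `𝒮_†`, with the indices `j` counted from `0`. -/
theorem connSDag_apply (k ℓ : ℕ) (ω : Form V (k + 1) ℓ) (v : Fin k → V) (u : Fin (ℓ + 1) → V) :
    connSDag V (k + 1) ℓ ω v u =
      ∑ j : Fin (ℓ + 1), (-1 : ℝ) ^ (j : ℕ) * ω (Matrix.vecCons (u j) v) (j.removeNth u) := by
  simp [connSDag, insertFst, AlternatingMap.alternatizeUncurryFin_apply]

variable (V)

/-- `𝒮_{[p]}^{k,ℓ} = 𝒮^{k+p-1,ℓ-p+1} ∘ ⋯ ∘ 𝒮^{k+1,ℓ-1} ∘ 𝒮^{k,ℓ} : Alt^{k,ℓ} → Alt^{k+p,ℓ-p}`. -/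
def iterS (k ℓ : ℕ) : (p : ℕ) → Form V k ℓ →ₗ[ℝ] Form V (k + p) (ℓ - p)
  | 0 => LinearMap.id
  | p + 1 => connS V (k + p) (ℓ - p) ∘ₗ iterS k ℓ p

/-- `𝒮_{†,[p]}^{k,ℓ} = 𝒮_†^{k-p+1,ℓ+p-1} ∘ ⋯ ∘ 𝒮_†^{k-1,ℓ+1} ∘ 𝒮_†^{k,ℓ} :
Alt^{k,ℓ} → Alt^{k-p,ℓ+p}`. -/
def iterSDag (k ℓ : ℕ) : (p : ℕ) → Form V k ℓ →ₗ[ℝ] Form V (k - p) (ℓ + p)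
  | 0 => LinearMap.id
  | p + 1 => connSDag V (k - p) (ℓ + p) ∘ₗ iterSDag k ℓ p

/-- `𝕎_{[p]}^{k,ℓ}(V) = ker 𝒮_{†,[p]}^{k,ℓ}`. -/
def W (k ℓ p : ℕ) : Submodule ℝ (Form V k ℓ) := LinearMap.ker (iterSDag V k ℓ p)

/-- The identity `Alt^{k,ℓ} = Alt^{k',ℓ'}` for `k = k'` and `ℓ = ℓ'`. -/
def degreeCast {k ℓ k' ℓ' : ℕ} (hk : k = k') (hℓ : ℓ = ℓ') : Form V k ℓ →ₗ[ℝ] Form V k' ℓ' where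
  toFun ω := (AlternatingMap.domDomCongrₗ ℝ (finCongr hℓ)).toLinearMap.compAlternatingMap
    (ω.domDomCongr (finCongr hk))
  map_add' _ _ := by ext; simp
  map_smul' _ _ := by ext; simp

/-- The composition `𝒮_{[s]}^{k-s,ℓ+s} ∘ 𝒮_{†,[ℓ-k+2s]}^{ℓ+s,k-s} : Alt^{ℓ+s,k-s} → Alt^{k,ℓ}`. -/
def mirrorMap {k ℓ s : ℕ} (hsk : s ≤ k) (hkℓ : k ≤ ℓ) :
    Form V (ℓ + s) (k - s) →ₗ[ℝ] Form V k ℓ :=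
  degreeCast V (show k - s + s = k by omega) (show ℓ + s - s = ℓ by omega) ∘ₗ
    iterS V (k - s) (ℓ + s) s ∘ₗ
    degreeCast V (show ℓ + s - (ℓ - k + 2 * s) = k - s by omega)
      (show k - s + (ℓ - k + 2 * s) = ℓ + s by omega) ∘ₗ
    iterSDag V (ℓ + s) (k - s) (ℓ - k + 2 * s)

variable {V}

/-- Pullback of both factors of a form-valued form along a linear map. -/
def pullback {U : Type*} [AddCommGroup U] [Module ℝ U] (f : U →ₗ[ℝ] V) (k ℓ : ℕ) :
    Form V k ℓ →ₗ[ℝ] Form U k ℓ where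
  toFun ω :=
    LinearMap.compAlternatingMap
      { toFun := fun β => β.compLinearMap f
        map_add' := fun _ _ => rfl
        map_smul' := fun _ _ => rfl }
      (ω.compLinearMap f)
  map_add' _ _ := rfl
  map_smul' _ _ := rfl

theorem pullback_apply {U : Type*} [AddCommGroup U] [Module ℝ U] (f : U →ₗ[ℝ] V) (k ℓ : ℕ)
    (ω : Form V k ℓ) (v : Fin k → U) (u : Fin ℓ → U) :
    pullback f k ℓ ω v u = ω (fun i => f (v i)) (fun i => f (u i)) := rfl

/-- The Frobenius inner product of form-valued forms, for which the forms `e^I ⊗ e^J` with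
increasing `I`, `J` are orthonormal whenever `e` is an orthonormal basis. It is written as a sum over
all index tuples, each increasing pair `(I, J)` occurring `k! ℓ!` times up to sign. -/
def frobenius {U : Type*} [NormedAddCommGroup U] [InnerProductSpace ℝ U] [FiniteDimensional ℝ U]
    {k ℓ : ℕ} (ω η : Form U k ℓ) : ℝ :=
  ((k.factorial : ℝ) * (ℓ.factorial : ℝ))⁻¹ *
    ∑ I : Fin k → Fin (Module.finrank ℝ U), ∑ J : Fin ℓ → Fin (Module.finrank ℝ U),
      ω (fun i => stdOrthonormalBasis ℝ U (I i)) (fun j => stdOrthonormalBasis ℝ U (J j)) *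
      η (fun i => stdOrthonormalBasis ℝ U (I i)) (fun j => stdOrthonormalBasis ℝ U (J j))

end Algebra

/-! ### Form-valued forms on simplices

A simplex of `ℝⁿ` is given by its finite, nonempty, affinely independent set of vertices `σ`; as a
point set it is `convexHull ℝ σ`, and its subsimplices are the nonempty subsets of `σ`. -/

section Simplex

variable {n : ℕ}

/-- The tangent space of the simplex with vertex set `σ`. -/
abbrev tangent (σ : Finset (EuclideanSpace ℝ (Fin n))) :
    Submodule ℝ (EuclideanSpace ℝ (Fin n)) :=
  vectorSpan ℝ (σ : Set (EuclideanSpace ℝ (Fin n)))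

/-- The double trace `ι_σ^* ι_σ^*` of a constant form-valued form of `ℝⁿ`. -/
def trace (σ : Finset (EuclideanSpace ℝ (Fin n))) (k ℓ : ℕ) :
    Form (EuclideanSpace ℝ (Fin n)) k ℓ →ₗ[ℝ] Form (tangent σ) k ℓ :=
  pullback (tangent σ).subtype k ℓ

/-- The double trace `ι_F^* ι_F^*` from a simplex `σ` to a subsimplex `F`, at a single point. -/
def faceTrace {F σ : Finset (EuclideanSpace ℝ (Fin n))} (h : F ⊆ σ) (k ℓ : ℕ) :
    Form (tangent σ) k ℓ →ₗ[ℝ] Form (tangent F) k ℓ :=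
  pullback (Submodule.inclusion (vectorSpan_mono ℝ (Finset.coe_subset.2 h))) k ℓ

/-- Fields of form-valued forms on `σ`, as functions of the point `x`. The fields used below are
affine in `x` and constant in the directions normal to `σ`, so that they are determined by their
values at the points of `σ`. -/
abbrev Field (σ : Finset (EuclideanSpace ℝ (Fin n))) (k ℓ : ℕ) : Type :=
  EuclideanSpace ℝ (Fin n) → Form (tangent σ) k ℓ

/-- The Koszul operator on constant forms: `(κ c)_x (v₁, …, v_k) = c (x, v₁, …, v_k)` for `x ∈ σ`,
where the Euler field `x` enters through its component tangent to `σ`. -/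
def koszul (σ : Finset (EuclideanSpace ℝ (Fin n))) (k ℓ : ℕ) :
    Form (tangent σ) (k + 1) ℓ →ₗ[ℝ] Field σ k ℓ where
  toFun c := fun x => c.curryLeft ((tangent σ).orthogonalProjectionOnto x)
  map_add' _ _ := rfl
  map_smul' _ _ := rfl

/-- Constant fields. -/
def constField (σ : Finset (EuclideanSpace ℝ (Fin n))) (k ℓ : ℕ) :
    Form (tangent σ) k ℓ →ₗ[ℝ] Field σ k ℓ where
  toFun a := fun _ => a
  map_add' _ _ := rfl
  map_smul' _ _ := rfl

/-- `𝒫⁻Alt^{k,ℓ}(σ) = Alt^{k,ℓ}(σ) + κ Alt^{k+1,ℓ}(σ)`. -/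
def whitney (σ : Finset (EuclideanSpace ℝ (Fin n))) (k ℓ : ℕ) : Submodule ℝ (Field σ k ℓ) :=
  LinearMap.range (constField σ k ℓ) ⊔ LinearMap.range (koszul σ k ℓ)

/-- `ℬ⁻Alt^{k,ℓ}(σ)`: the fields in `𝒫⁻Alt^{k,ℓ}(σ)` whose double trace vanishes on every proper
subsimplex of `σ`. -/
def bubble (σ : Finset (EuclideanSpace ℝ (Fin n))) (k ℓ : ℕ) : Submodule ℝ (Field σ k ℓ) where
  carrier := {ω | ω ∈ whitney σ k ℓ ∧ ∀ (F : Finset (EuclideanSpace ℝ (Fin n))) (h : F ⊂ σ),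
    F.Nonempty → ∀ x ∈ convexHull ℝ (F : Set (EuclideanSpace ℝ (Fin n))),
      faceTrace h.subset k ℓ (ω x) = 0}
  add_mem' ha hb := ⟨add_mem ha.1 hb.1, fun F h hF x hx => by
    rw [Pi.add_apply, map_add, ha.2 F h hF x hx, hb.2 F h hF x hx, add_zero]⟩
  zero_mem' := ⟨zero_mem _, fun F h _ x _ => by rw [Pi.zero_apply, map_zero]⟩
  smul_mem' c _ ha := ⟨Submodule.smul_mem _ c ha.1, fun F h hF x hx => by
    rw [Pi.smul_apply, map_smul, ha.2 F h hF x hx, smul_zero]⟩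

/-- `ℬ⁻𝕎_{[p]}^{k,ℓ}(σ) = ker (𝒮_{†,[p]} : ℬ⁻Alt^{k,ℓ}(σ) → ℬ⁻Alt^{k-p,ℓ+p}(σ))`. -/
def bubbleW (σ : Finset (EuclideanSpace ℝ (Fin n))) (k ℓ p : ℕ) : Submodule ℝ (Field σ k ℓ) :=
  bubble σ k ℓ ⊓
    LinearMap.ker ((iterSDag (tangent σ) k ℓ p).compLeft (EuclideanSpace ℝ (Fin n)))

/-- The summand
`𝒮_{[s]}^{k-s,ℓ+s} 𝒮_{†,[ℓ-k+2s]}^{ℓ+s,k-s} ℬ⁻𝕎_{[ℓ-k+2s+1]}^{ℓ+s,k-s}(σ)` of the test space. -/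
def testSummand (σ : Finset (EuclideanSpace ℝ (Fin n))) {k ℓ s : ℕ} (hsk : s ≤ k) (hkℓ : k ≤ ℓ) :
    Submodule ℝ (Field σ k ℓ) :=
  (bubbleW σ (ℓ + s) (k - s) (ℓ - k + 2 * s + 1)).map
    ((mirrorMap (tangent σ) hsk hkℓ).compLeft (EuclideanSpace ℝ (Fin n)))

/-- The test space on `σ`: the sum of the above summands over `0 ≤ s ≤ p - 1`. -/
def testSpace (σ : Finset (EuclideanSpace ℝ (Fin n))) {k ℓ p : ℕ} (hpk : p ≤ k) (hkℓ : k ≤ ℓ) :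
    Submodule ℝ (Field σ k ℓ) :=
  ⨆ s : Fin p, testSummand σ (s.is_lt.le.trans hpk) hkℓ

/-- The `L²` inner product `⟨a, b⟩_σ` of two fields on `σ`, the integral being taken with respect to
the Lebesgue measure of dimension `dim σ` (evaluation at the point if `σ` is a vertex). -/
def l2Inner (σ : Finset (EuclideanSpace ℝ (Fin n))) {k ℓ : ℕ} (a b : Field σ k ℓ) : ℝ :=
  ∫ x in convexHull ℝ (σ : Set (EuclideanSpace ℝ (Fin n))), frobenius (a x) (b x)
    ∂(μHE[Module.finrank ℝ (tangent σ)])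

/-- The degree of freedom `⟨ι_σ^* ι_σ^* ω, b⟩_σ` of a constant form-valued form `ω`. -/
def dof (σ : Finset (EuclideanSpace ℝ (Fin n))) {k ℓ : ℕ}
    (ω : Form (EuclideanSpace ℝ (Fin n)) k ℓ) (b : Field σ k ℓ) : ℝ :=
  l2Inner σ (constField σ k ℓ (trace σ k ℓ ω)) b

/-- The degrees of freedom `⟨ι_σ^* ι_σ^* ω, b⟩_σ`, `b ∈ B σ`, over all subsimplices `σ` of `K` are
unisolvent for the shape function space `X`: any prescribed values of them (which have to depend
linearly on `b`) are attained by exactly one shape function. -/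
def IsUnisolvent (K : Finset (EuclideanSpace ℝ (Fin n))) {k ℓ : ℕ}
    (X : Submodule ℝ (Form (EuclideanSpace ℝ (Fin n)) k ℓ))
    (B : (σ : Finset (EuclideanSpace ℝ (Fin n))) → Submodule ℝ (Field σ k ℓ)) : Prop :=
  ∀ L : (σ : Finset (EuclideanSpace ℝ (Fin n))) → Module.Dual ℝ (B σ),
    ∃! ω : Form (EuclideanSpace ℝ (Fin n)) k ℓ, ω ∈ X ∧
      ∀ σ : Finset (EuclideanSpace ℝ (Fin n)), σ.Nonempty → σ ⊆ K →
        ∀ b : B σ, dof σ ω b = L σ b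

/-- The `n`-simplices of a triangulation `T` in `ℝⁿ`. -/
abbrev Cell (T : Geometry.SimplicialComplex ℝ (EuclideanSpace ℝ (Fin n))) : Type :=
  {K : Finset (EuclideanSpace ℝ (Fin n)) // K ∈ T.faces ∧ K.card = n + 1}

/-- The piecewise constant finite element space on `T` with shape functions `X` on each cell and
with degrees of freedom `⟨ι_σ^* ι_σ^* ω, b⟩_σ`, `b ∈ B σ`, that are shared by the cells around each
simplex `σ` of `T`. A piecewise constant field is given by its value on each cell. -/
def feSpace (T : Geometry.SimplicialComplex ℝ (EuclideanSpace ℝ (Fin n))) {k ℓ : ℕ}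
    (X : Submodule ℝ (Form (EuclideanSpace ℝ (Fin n)) k ℓ))
    (B : (σ : Finset (EuclideanSpace ℝ (Fin n))) → Submodule ℝ (Field σ k ℓ)) :
    Set (Cell T → Form (EuclideanSpace ℝ (Fin n)) k ℓ) :=
  {u | (∀ K, u K ∈ X) ∧ ∀ σ ∈ T.faces, ∀ K K' : Cell T, σ ⊆ K.1 → σ ⊆ K'.1 →
    ∀ b ∈ B σ, dof σ (u K) b = dof σ (u K') b}

/-- `ι^*ι^*`-conformity: the double trace is single-valued on every simplex of `T`, of any
dimension. -/
def IsConforming (T : Geometry.SimplicialComplex ℝ (EuclideanSpace ℝ (Fin n))) {k ℓ : ℕ}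
    (u : Cell T → Form (EuclideanSpace ℝ (Fin n)) k ℓ) : Prop :=
  ∀ σ ∈ T.faces, ∀ K K' : Cell T, σ ⊆ K.1 → σ ⊆ K'.1 → trace σ k ℓ (u K) = trace σ k ℓ (u K')

end Simplex

end FormValued

end

/-! The operators `gS`, `gSd` and `degL - degR` make the form-valued forms of all degrees a
representation of sl₂ (`gS_mul_gSd`), with weight k - ℓ in degree (k, ℓ) and with pullbacks
equivariant. Two results reduce the theorem to linear algebra.

The test space consists of constant fields: it is exactly the set of constant forms in 𝕎_{[p]}(σ)
whose traces vanish on all proper faces (`testSpace_eq`). A bubble in a summand has the form A + κc.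
Since 𝒮_†^{m+1} kills every contraction of c, it kills c itself, and 𝒮_†^{m+1} is injective in the
weight m + 1 of c, so c = 0. The summands are then the pieces of 𝕎_{[p]} generated by lowest-weight
vectors s steps below degree (k, ℓ). They exhaust 𝕎_{[p]}, compatibly with traces, because each
lowest-weight vector can be raised to the mirror degree and brought back up to a nonzero scalar.
They are independent because 𝒮𝒮_† acts on the s-th one by s(ℓ - k + s + 1).

Extension of bubbles (`exists_trace_eq`): a trace-free form on σ is the trace of a form in
𝕎_{[p]}(ℝⁿ) that vanishes on every subsimplex not containing σ. T_σ is realised as the kernel of s =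
∑ λᵢ in the coordinate space ℝ^σ. The operator `diagOp` commutes with 𝒮_†, is natural for coordinate
subspaces, produces forms vanishing on ker s, and is injective on the forms of 𝕎_{[p]} vanishing on
ker s (`eq_zero_of_diagOp_eq_zero`). By finite dimension every form on ker s that comes from 𝕎_{[p]}
has a lift annihilated by `diagOp`. By naturality and injectivity this lift vanishes on each
coordinate subspace ℝ^ρ, ρ ⊊ σ. Barycentric coordinates pull it back to ℝⁿ.

Given both, a form with zero degrees of freedom has zero traces by induction on faces, each trace
being tested against itself. This yields uniqueness and conformity. Existence solves a triangular
system by bubble extension, simplex by simplex in order of dimension. -/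

noncomputable section

namespace FormValued

/-! ### Exterior multiplication by a linear functional. -/

section Wedge

variable {V M N : Type*} [AddCommGroup V] [Module ℝ V] [AddCommGroup M] [Module ℝ M]
  [AddCommGroup N] [Module ℝ N]

/-- The exterior product `θ ∧ α` of a linear functional with an alternating map. -/
def wedgeOne (n : ℕ) : (V →ₗ[ℝ] ℝ) →ₗ[ℝ] (V [⋀^Fin n]→ₗ[ℝ] M) →ₗ[ℝ] V [⋀^Fin (n + 1)]→ₗ[ℝ] M :=
  (LinearMap.smulRightₗ).compr₂ AlternatingMap.alternatizeUncurryFinLM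

theorem wedgeOne_apply (n : ℕ) (θ : V →ₗ[ℝ] ℝ) (α : V [⋀^Fin n]→ₗ[ℝ] M) (v : Fin (n + 1) → V) :
    wedgeOne n θ α v = ∑ j : Fin (n + 1), (-1 : ℝ) ^ (j : ℕ) • θ (v j) • α (j.removeNth v) := by
  simp only [wedgeOne, LinearMap.compr₂_apply, AlternatingMap.alternatizeUncurryFinLM_apply,
    AlternatingMap.alternatizeUncurryFin_apply]
  refine Finset.sum_congr rfl fun j _ => ?_
  rcases Nat.even_or_odd (j : ℕ) with h | h <;> simp [h.neg_one_pow]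

theorem curryLeft_wedgeOne_zero (θ : V →ₗ[ℝ] ℝ) (α : V [⋀^Fin 0]→ₗ[ℝ] M) (w : V) :
    (wedgeOne 0 θ α).curryLeft w = θ w • α := by
  ext v
  simp [wedgeOne_apply]

theorem removeNth_succ_vecCons {X : Type*} {n : ℕ} (j : Fin (n + 1)) (w : X) (v : Fin (n + 1) → X) :
    j.succ.removeNth (Matrix.vecCons w v : Fin (n + 2) → X) = Matrix.vecCons w (j.removeNth v) := by
  ext i
  refine Fin.cases ?_ (fun i => ?_) i <;> simp [Fin.removeNth_apply]

theorem curryLeft_wedgeOne_succ {n : ℕ} (θ : V →ₗ[ℝ] ℝ) (α : V [⋀^Fin (n + 1)]→ₗ[ℝ] M) (w : V) :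
    (wedgeOne (n + 1) θ α).curryLeft w = θ w • α - wedgeOne n θ (α.curryLeft w) := by
  ext v
  simp only [AlternatingMap.curryLeft_apply_apply, wedgeOne_apply, AlternatingMap.sub_apply,
    AlternatingMap.smul_apply]
  rw [Fin.sum_univ_succ, sub_eq_add_neg, ← Finset.sum_neg_distrib]
  congr 1
  · simp
  · refine Finset.sum_congr rfl fun j _ => ?_
    rw [removeNth_succ_vecCons]
    simp [pow_succ]

/-- The bilinear expression θ(x)θ(y)α is symmetric in x and y, so alternating it twice gives zero.
-/
theorem wedgeOne_wedgeOne_self (n : ℕ) (θ : V →ₗ[ℝ] ℝ) (α : V [⋀^Fin n]→ₗ[ℝ] M) :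
    wedgeOne (n + 1) θ (wedgeOne n θ α) = 0 := by
  have h := AlternatingMap.alternatizeUncurryFin_alternatizeUncurryFinLM_comp_of_symmetric
    (f := θ.smulRight (θ.smulRight α)) (fun x y => by simp [smul_comm (θ x)])
  rw [← h]
  change AlternatingMap.alternatizeUncurryFin _ = _
  congr 1
  ext x : 1
  simp [wedgeOne]

theorem wedgeOne_compAlternatingMap (n : ℕ) (θ : V →ₗ[ℝ] ℝ) (α : V [⋀^Fin n]→ₗ[ℝ] M)
    (φ : M →ₗ[ℝ] N) :
    φ.compAlternatingMap (wedgeOne n θ α) = wedgeOne n θ (φ.compAlternatingMap α) := by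
  ext v
  simp [wedgeOne_apply, map_sum, map_smul]

end Wedge

/-! ### Contractions and exterior products on forms of all degrees. -/

section Graded

variable (V : Type*) [AddCommGroup V] [Module ℝ V]

/-- Form-valued forms of all degrees. -/
structure GForm where
  /-- The components. -/
  toFun : ∀ k ℓ : ℕ, Form V k ℓ

/-- Form-valued forms of all degrees as families of forms. -/
def GForm.equivPi : GForm V ≃ ∀ k ℓ : ℕ, Form V k ℓ :=
  ⟨GForm.toFun, GForm.mk, fun _ => rfl, fun _ => rfl⟩

instance : CoeFun (GForm V) fun _ => ∀ k ℓ : ℕ, Form V k ℓ := ⟨GForm.toFun⟩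

instance : AddCommGroup (GForm V) := (GForm.equivPi V).addCommGroup

instance : Module ℝ (GForm V) := (GForm.equivPi V).module ℝ

instance : Ring (Module.End ℝ (GForm V)) := Module.End.instRing

instance : Algebra ℝ (Module.End ℝ (GForm V)) := Module.End.instAlgebra ℝ ℝ (GForm V)

variable {V}

@[simp] theorem GForm.add_apply (f g : GForm V) (k ℓ : ℕ) : (f + g) k ℓ = f k ℓ + g k ℓ := rfl

@[simp] theorem GForm.sub_apply (f g : GForm V) (k ℓ : ℕ) : (f - g) k ℓ = f k ℓ - g k ℓ := rfl

@[simp] theorem GForm.zero_apply (k ℓ : ℕ) : (0 : GForm V) k ℓ = 0 := rfl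

@[simp] theorem GForm.smul_apply (c : ℝ) (f : GForm V) (k ℓ : ℕ) : (c • f) k ℓ = c • f k ℓ := rfl

@[ext] theorem GForm.ext {f g : GForm V} (h : ∀ k ℓ, f k ℓ = g k ℓ) : f = g :=
  (GForm.equivPi V).injective (funext fun k => funext fun ℓ => h k ℓ)

theorem GForm.congr_apply {f g : GForm V} (h : f = g) (k ℓ : ℕ) : f k ℓ = g k ℓ := by rw [h]

theorem GForm.ext_apply {f g : GForm V}
    (h : ∀ k ℓ (v : Fin k → V) (u : Fin ℓ → V), f k ℓ v u = g k ℓ v u) : f = g :=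
  GForm.ext fun k ℓ => AlternatingMap.ext fun v => AlternatingMap.ext fun u => h k ℓ v u

/-- Insertion of a vector in the first factor. -/
def insL : V →ₗ[ℝ] Module.End ℝ (GForm V) where
  toFun w :=
    { toFun := fun f => .mk fun k ℓ => (f (k + 1) ℓ).curryLeft w
      map_add' := fun _ _ => rfl
      map_smul' := fun _ _ => rfl }
  map_add' w w' := LinearMap.ext fun f => GForm.ext fun k ℓ =>
    map_add ((f (k + 1) ℓ).curryLeft) w w'
  map_smul' c w := LinearMap.ext fun f => GForm.ext fun k ℓ =>
    map_smul ((f (k + 1) ℓ).curryLeft) c w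

/-- Insertion of a vector in the second factor. -/
def insR : V →ₗ[ℝ] Module.End ℝ (GForm V) where
  toFun w :=
    { toFun := fun f => .mk fun k ℓ => insertSnd (f k (ℓ + 1)) w
      map_add' := fun _ _ => rfl
      map_smul' := fun _ _ => rfl }
  map_add' w w' := LinearMap.ext fun f => GForm.ext fun k ℓ =>
    map_add (insertSnd (f k (ℓ + 1))) w w'
  map_smul' c w := LinearMap.ext fun f => GForm.ext fun k ℓ =>
    map_smul (insertSnd (f k (ℓ + 1))) c w

/-- The component of degree `(k, ℓ)`. -/
def gComp (k ℓ : ℕ) : GForm V →ₗ[ℝ] Form V k ℓ where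
  toFun f := f k ℓ
  map_add' _ _ := rfl
  map_smul' _ _ := rfl

/-- The linear map into `GForm U` with given components. -/
def gLift {U X : Type*} [AddCommGroup U] [Module ℝ U] [AddCommMonoid X] [Module ℝ X]
    (φ : ∀ k ℓ, X →ₗ[ℝ] Form U k ℓ) : X →ₗ[ℝ] GForm U where
  toFun x := .mk fun k ℓ => φ k ℓ x
  map_add' _ _ := GForm.ext fun k ℓ => map_add (φ k ℓ) _ _
  map_smul' _ _ := GForm.ext fun k ℓ => map_smul (φ k ℓ) _ _

/-- Exterior multiplication by a linear functional in the first factor. -/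
def wedL : (V →ₗ[ℝ] ℝ) →ₗ[ℝ] Module.End ℝ (GForm V) where
  toFun θ := gLift fun k ℓ => match k with
    | 0 => 0
    | k + 1 => wedgeOne k θ ∘ₗ gComp k ℓ
  map_add' θ η := LinearMap.ext fun f => GForm.ext fun k ℓ => by
    cases k
    · exact (add_zero _).symm
    · exact LinearMap.congr_fun (map_add (wedgeOne _) θ η) _
  map_smul' c θ := LinearMap.ext fun f => GForm.ext fun k ℓ => by
    cases k
    · exact (smul_zero c).symm
    · exact LinearMap.congr_fun (map_smul (wedgeOne _) c θ) _

/-- Composition of the second factor of a form-valued form with a linear map. -/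
def mapSnd (k : ℕ) {ℓ m : ℕ} :
    ((V [⋀^Fin ℓ]→ₗ[ℝ] ℝ) →ₗ[ℝ] V [⋀^Fin m]→ₗ[ℝ] ℝ) →ₗ[ℝ] Form V k ℓ →ₗ[ℝ] Form V k m where
  toFun φ :=
    { toFun := fun ω => φ.compAlternatingMap ω
      map_add' := fun _ _ => AlternatingMap.ext fun _ => map_add φ _ _
      map_smul' := fun c _ => AlternatingMap.ext fun _ => map_smul φ c _ }
  map_add' _ _ := rfl
  map_smul' _ _ := rfl

/-- Exterior multiplication by a linear functional in the second factor. -/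
def wedR : (V →ₗ[ℝ] ℝ) →ₗ[ℝ] Module.End ℝ (GForm V) where
  toFun θ := gLift fun k ℓ => match ℓ with
    | 0 => 0
    | ℓ + 1 => mapSnd k (wedgeOne ℓ θ) ∘ₗ gComp k ℓ
  map_add' θ η := LinearMap.ext fun f => GForm.ext fun k ℓ => by
    cases ℓ
    · exact (add_zero _).symm
    · exact AlternatingMap.ext fun v => LinearMap.congr_fun (map_add (wedgeOne _) θ η) _
  map_smul' c θ := LinearMap.ext fun f => GForm.ext fun k ℓ => by
    cases ℓ
    · exact (smul_zero c).symm
    · exact AlternatingMap.ext fun v => LinearMap.congr_fun (map_smul (wedgeOne _) c θ) _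

/-- `𝒮` in all degrees. -/
def gS : Module.End ℝ (GForm V) := gLift fun k ℓ => match k with
  | 0 => 0
  | k + 1 => connS V k (ℓ + 1) ∘ₗ gComp k (ℓ + 1)

/-- `𝒮_†` in all degrees. -/
def gSd : Module.End ℝ (GForm V) := gLift fun k ℓ => match ℓ with
  | 0 => 0
  | ℓ + 1 => connSDag V (k + 1) ℓ ∘ₗ gComp (k + 1) ℓ

/-- The degree in the first factor. -/
def degL : Module.End ℝ (GForm V) := gLift fun k ℓ => (k : ℝ) • gComp k ℓ

/-- The degree in the second factor. -/
def degR : Module.End ℝ (GForm V) := gLift fun k ℓ => (ℓ : ℝ) • gComp k ℓ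

/-- Pullback in all degrees. -/
def gPull {U : Type*} [AddCommGroup U] [Module ℝ U] (g : U →ₗ[ℝ] V) : GForm V →ₗ[ℝ] GForm U :=
  gLift fun k ℓ => pullback g k ℓ ∘ₗ gComp k ℓ

theorem gS_zero (f : GForm V) (ℓ : ℕ) : gS f 0 ℓ = 0 := rfl

theorem gSd_zero (f : GForm V) (k : ℕ) : gSd f k 0 = 0 := rfl

theorem degL_apply (f : GForm V) (k ℓ : ℕ) : degL f k ℓ = (k : ℝ) • f k ℓ := rfl

theorem degR_apply (f : GForm V) (k ℓ : ℕ) : degR f k ℓ = (ℓ : ℝ) • f k ℓ := rfl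

theorem gPull_apply {U : Type*} [AddCommGroup U] [Module ℝ U] (g : U →ₗ[ℝ] V) (f : GForm V)
    (k ℓ : ℕ) : gPull g f k ℓ = pullback g k ℓ (f k ℓ) := rfl

theorem insL_apply (w : V) (f : GForm V) (k ℓ : ℕ) (v : Fin k → V) (u : Fin ℓ → V) :
    insL w f k ℓ v u = f (k + 1) ℓ (Matrix.vecCons w v) u := rfl

theorem insR_apply (w : V) (f : GForm V) (k ℓ : ℕ) (v : Fin k → V) (u : Fin ℓ → V) :
    insR w f k ℓ v u = f k (ℓ + 1) v (Matrix.vecCons w u) := rfl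

theorem wedL_zero (θ : V →ₗ[ℝ] ℝ) (f : GForm V) (ℓ : ℕ) : wedL θ f 0 ℓ = 0 := rfl

theorem wedR_zero (θ : V →ₗ[ℝ] ℝ) (f : GForm V) (k : ℕ) : wedR θ f k 0 = 0 := rfl

theorem wedR_succ (θ : V →ₗ[ℝ] ℝ) (f : GForm V) (k ℓ : ℕ) :
    wedR θ f k (ℓ + 1) = (wedgeOne ℓ θ).compAlternatingMap (f k ℓ) := rfl

theorem wedL_apply (θ : V →ₗ[ℝ] ℝ) (f : GForm V) (k ℓ : ℕ) (v : Fin (k + 1) → V) (u : Fin ℓ → V) :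
    wedL θ f (k + 1) ℓ v u =
      ∑ j : Fin (k + 1), (-1 : ℝ) ^ (j : ℕ) * (θ (v j) * f k ℓ (j.removeNth v) u) := by
  let ev : (V [⋀^Fin ℓ]→ₗ[ℝ] ℝ) →ₗ[ℝ] ℝ :=
    { toFun := fun β => β u, map_add' := fun _ _ => rfl, map_smul' := fun _ _ => rfl }
  change ev (wedgeOne k θ (f k ℓ) v) = _
  rw [wedgeOne_apply, map_sum]
  exact Finset.sum_congr rfl fun j _ => by simp [ev]

theorem wedR_apply (θ : V →ₗ[ℝ] ℝ) (f : GForm V) (k ℓ : ℕ) (v : Fin k → V) (u : Fin (ℓ + 1) → V) :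
    wedR θ f k (ℓ + 1) v u =
      ∑ j : Fin (ℓ + 1), (-1 : ℝ) ^ (j : ℕ) * (θ (u j) * f k ℓ v (j.removeNth u)) := by
  rw [wedR_succ, LinearMap.compAlternatingMap_apply, wedgeOne_apply]
  simp

theorem gS_apply (f : GForm V) (k ℓ : ℕ) (v : Fin (k + 1) → V) (u : Fin ℓ → V) :
    gS f (k + 1) ℓ v u = ∑ j : Fin (k + 1),
      (-1 : ℝ) ^ (j : ℕ) * f k (ℓ + 1) (j.removeNth v) (Matrix.vecCons (v j) u) :=
  connS_apply ..

theorem gSd_apply (f : GForm V) (k ℓ : ℕ) (v : Fin k → V) (u : Fin (ℓ + 1) → V) :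
    gSd f k (ℓ + 1) v u = ∑ j : Fin (ℓ + 1),
      (-1 : ℝ) ^ (j : ℕ) * f (k + 1) ℓ (Matrix.vecCons (u j) v) (j.removeNth u) :=
  connSDag_apply ..

theorem insL_mul_self (w : V) : insL w * insL w = 0 := by
  refine LinearMap.ext fun f => GForm.ext fun k ℓ => ?_
  exact AlternatingMap.curryLeft_same _ _

theorem insR_mul_self (w : V) : insR w * insR w = 0 := by
  refine LinearMap.ext fun f => GForm.ext_apply fun k ℓ v u => ?_
  exact (f k (ℓ + 2) v).map_eq_zero_of_eq (i := 0) (j := 1) _ rfl (by simp)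

/-- Polarization of φ(x + y)² = 0. -/
theorem anticomm_of_sq_zero {X A : Type*} [AddCommGroup X] [Module ℝ X] [Ring A] [Algebra ℝ A]
    (φ : X →ₗ[ℝ] A) (h : ∀ x, φ x * φ x = 0) (x y : X) : φ x * φ y = -(φ y * φ x) := by
  have h1 := h (x + y)
  rw [map_add, add_mul, mul_add, mul_add, h, h, zero_add, add_zero] at h1
  exact eq_neg_of_add_eq_zero_left h1

theorem insL_anticomm (w w' : V) : insL w * insL w' = -(insL w' * insL w) :=
  anticomm_of_sq_zero insL insL_mul_self w w'

theorem insR_anticomm (w w' : V) : insR w * insR w' = -(insR w' * insR w) :=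
  anticomm_of_sq_zero insR insR_mul_self w w'

theorem wedR_mul_self (θ : V →ₗ[ℝ] ℝ) : wedR θ * wedR θ = 0 := by
  refine LinearMap.ext fun f => GForm.ext fun k ℓ => ?_
  rcases ℓ with _ | _ | ℓ
  · rfl
  · ext v : 1
    change wedgeOne 0 θ (0 : V [⋀^Fin 0]→ₗ[ℝ] ℝ) = 0
    simp
  · ext v : 1
    exact wedgeOne_wedgeOne_self ℓ θ (f k ℓ v)

theorem wedR_anticomm (θ η : V →ₗ[ℝ] ℝ) : wedR θ * wedR η = -(wedR η * wedR θ) :=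
  anticomm_of_sq_zero wedR wedR_mul_self θ η

/-- Canonical anticommutation relation within one tensor factor. Operators on different factors
commute without a sign. -/
theorem insL_mul_wedL (w : V) (θ : V →ₗ[ℝ] ℝ) :
    insL w * wedL θ = θ w • (1 : Module.End ℝ (GForm V)) - wedL θ * insL w := by
  refine LinearMap.ext fun f => GForm.ext fun k ℓ => ?_
  rcases k with _ | k
  · exact (curryLeft_wedgeOne_zero θ (f 0 ℓ) w).trans (sub_zero (θ w • f 0 ℓ)).symm
  · exact curryLeft_wedgeOne_succ θ (f (k + 1) ℓ) w

theorem insR_mul_wedR (w : V) (θ : V →ₗ[ℝ] ℝ) :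
    insR w * wedR θ = θ w • (1 : Module.End ℝ (GForm V)) - wedR θ * insR w := by
  refine LinearMap.ext fun f => GForm.ext fun k ℓ => ?_
  rcases ℓ with _ | ℓ
  · ext v : 1
    exact (curryLeft_wedgeOne_zero θ (f k 0 v) w).trans (sub_zero (θ w • f k 0 v)).symm
  · ext v : 1
    exact curryLeft_wedgeOne_succ θ (f k (ℓ + 1) v) w

theorem insL_mul_insR (w w' : V) : insL w * insR w' = insR w' * insL w := rfl

theorem insL_mul_wedR (w : V) (θ : V →ₗ[ℝ] ℝ) : insL w * wedR θ = wedR θ * insL w := by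
  refine LinearMap.ext fun f => GForm.ext fun k ℓ => ?_
  rcases ℓ with _ | ℓ <;> rfl

theorem insR_mul_wedL (w : V) (θ : V →ₗ[ℝ] ℝ) : insR w * wedL θ = wedL θ * insR w := by
  refine LinearMap.ext fun f => GForm.ext fun k ℓ => ?_
  rcases k with _ | k
  · ext; rfl
  · exact wedgeOne_compAlternatingMap k θ (f k (ℓ + 1)) _

theorem wedL_mul_wedR (θ η : V →ₗ[ℝ] ℝ) : wedL θ * wedR η = wedR η * wedL θ := by
  refine LinearMap.ext fun f => GForm.ext fun k ℓ => ?_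
  rcases k with _ | k <;> rcases ℓ with _ | ℓ
  · rfl
  · ext v : 1
    exact (map_zero (wedgeOne ℓ η)).symm
  · exact map_zero (wedgeOne k θ)
  · exact (wedgeOne_compAlternatingMap k θ (f k ℓ) _).symm

end Graded

/-! ### Abstract sl₂ computations with raising operator E, lowering operator F and weight H. -/

section Sl2

variable {M : Type*} [AddCommGroup M] [Module ℝ M] {E F H : Module.End ℝ M}

theorem pow_succ_apply' (A : Module.End ℝ M) (j : ℕ) (x : M) : (A ^ (j + 1)) x = A ((A ^ j) x) := by
  rw [pow_succ', Module.End.mul_apply]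

theorem weight_pow {A H : Module.End ℝ M} {d : ℝ} (h : ∀ x, H (A x) = A (H x) + d • A x) {x : M}
    {c : ℝ} (hx : H x = c • x) (j : ℕ) : H ((A ^ j) x) = (c + d * j) • (A ^ j) x := by
  induction j with
  | zero => simpa using hx
  | succ j ih =>
    rw [pow_succ_apply', h, ih, map_smul, ← add_smul]
    congr 1
    push_cast
    ring

/-- Moving E past the j + 1 factors F leaves H acting on the weights c, c - 2, …, c - 2j, whose sum
is (j + 1)(c - j). -/
theorem raise_lower_pow (hEF : ∀ x, E (F x) = F (E x) + H x)
    (hF : ∀ x, H (F x) = F (H x) + (-2 : ℝ) • F x)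
    {x : M} {c : ℝ} (hx : H x = c • x) (j : ℕ) :
    E ((F ^ (j + 1)) x) = (F ^ (j + 1)) (E x) + ((j + 1) * (c - j)) • (F ^ j) x := by
  induction j with
  | zero => simp [hEF, hx]
  | succ j ih =>
    rw [pow_succ_apply' F (j + 1), hEF, ih, weight_pow hF hx, map_add, map_smul,
      ← pow_succ_apply', ← pow_succ_apply', add_assoc, ← add_smul]
    congr 2
    push_cast
    ring

theorem lower_raise_pow (hEF : ∀ x, E (F x) = F (E x) + H x)
    (hE : ∀ x, H (E x) = E (H x) + (2 : ℝ) • E x)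
    {x : M} {c : ℝ} (hx : H x = (-c) • x) (j : ℕ) :
    F ((E ^ (j + 1)) x) = (E ^ (j + 1)) (F x) + ((j + 1) * (c - j)) • (E ^ j) x := by
  induction j with
  | zero => simp [hEF, hx]
  | succ j ih =>
    have h1 : F (E ((E ^ (j + 1)) x)) = E (F ((E ^ (j + 1)) x)) - H ((E ^ (j + 1)) x) := by
      rw [hEF]; abel
    rw [pow_succ_apply' E (j + 1), h1, ih, weight_pow hE hx, map_add, map_smul,
      ← pow_succ_apply', ← pow_succ_apply', add_sub_assoc, ← sub_smul]
    congr 2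
    push_cast
    ring

/-- For a lowest-weight vector the scalar is the product of the numbers i(m - i + 1) for 1 ≤ i ≤ j,
nonzero as long as j ≤ m. -/
theorem lower_pow_raise_pow (hEF : ∀ x, E (F x) = F (E x) + H x)
    (hE : ∀ x, H (E x) = E (H x) + (2 : ℝ) • E x)
    {x : M} {m : ℕ} (hx : H x = (-(m : ℝ)) • x) (hFx : F x = 0) (j : ℕ) (hj : j ≤ m) :
    ∃ c : ℝ, c ≠ 0 ∧ (F ^ j) ((E ^ j) x) = c • x := by
  induction j with
  | zero => exact ⟨1, one_ne_zero, by simp⟩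
  | succ j ih =>
    obtain ⟨c, hc, h⟩ := ih (by omega)
    refine ⟨(j + 1) * (m - j) * c, ?_, ?_⟩
    · have : (j : ℝ) + 1 ≤ m := by exact_mod_cast hj
      exact mul_ne_zero (mul_ne_zero (by positivity) (by linarith)) hc
    · rw [pow_succ F, Module.End.mul_apply, lower_raise_pow hEF hE hx, hFx, map_zero, zero_add,
        map_smul, h, smul_smul]

/-- Along x, Fx, F²x, … the operator E undoes F up to a nonzero scalar, so vanishing propagates back
to x. No weight vector is assumed, since one application concerns a vector not known to be killed by
E. -/
theorem eq_zero_of_lower_pow_of_raise_lower {x : M} {c : ℕ → ℝ} {q : ℕ} (hc : ∀ j < q, c j ≠ 0)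
    (h : ∀ j < q, E ((F ^ (j + 1)) x) = c j • (F ^ j) x) (hq : (F ^ q) x = 0) : x = 0 := by
  induction q with
  | zero => simpa using hq
  | succ q ih =>
    refine ih (fun j hj => hc j (by omega)) (fun j hj => h j (by omega)) ?_
    have h1 := h q (by omega)
    rw [hq, map_zero] at h1
    exact (smul_eq_zero.1 h1.symm).resolve_left (hc q (by omega))

/-- F^q is injective in weight m ≥ q when E acts nilpotently. The commutator formula gives
F^(q+1)(Ex) = 0 in weight m + 2, so induction on the nilpotency order yields Ex = 0, and a
highest-weight vector is handled by the explicit scalars. -/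
theorem eq_zero_of_lower_pow (hEF : ∀ x, E (F x) = F (E x) + H x)
    (hE : ∀ x, H (E x) = E (H x) + (2 : ℝ) • E x) (hF : ∀ x, H (F x) = F (H x) + (-2 : ℝ) • F x)
    (r : ℕ) {x : M} {m q : ℕ} (hr : (E ^ r) x = 0) (hx : H x = (m : ℝ) • x) (hq : (F ^ q) x = 0)
    (hqm : q ≤ m) : x = 0 := by
  induction r generalizing x m q with
  | zero => simpa using hr
  | succ r ih =>
    have hEx : E x = 0 := by
      refine ih (x := E x) (m := m + 2) (q := q + 1) ?_ ?_ ?_ (by omega)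
      · rwa [pow_succ, Module.End.mul_apply] at hr
      · rw [hE, hx, map_smul, ← add_smul]; push_cast; rfl
      · have h := raise_lower_pow hEF hF hx q
        rw [pow_succ_apply', hq, map_zero, map_zero, smul_zero, add_zero] at h
        rw [h.symm]
    refine eq_zero_of_lower_pow_of_raise_lower (E := E) (F := F) (c := fun j => (j + 1) * (m - j))
      (fun j hj => ?_) (fun j _ => ?_) hq
    · have : (j : ℝ) + 1 ≤ m := by exact_mod_cast (by omega : j + 1 ≤ m)
      exact mul_ne_zero (by positivity) (by linarith)
    · rw [raise_lower_pow hEF hF hx, hEx, map_zero, zero_add]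

end Sl2

/-! ### Expansion of the operators in dual families, and naturality under pullback. -/

section Expansion

variable {V : Type*} [AddCommGroup V] [Module ℝ V]

theorem sum_mul_insL {ι : Type*} [Fintype ι] {θ : ι → V →ₗ[ℝ] ℝ} {w : ι → V} {x y : V}
    (h : ∑ i, θ i x • w i = y) (f : GForm V) (k ℓ : ℕ) (v : Fin k → V) (u : Fin ℓ → V) :
    ∑ i, θ i x * f (k + 1) ℓ (Matrix.vecCons (w i) v) u = f (k + 1) ℓ (Matrix.vecCons y v) u := by
  let ev : V →ₗ[ℝ] ℝ :=
    { toFun := fun w => f (k + 1) ℓ (Matrix.vecCons w v) u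
      map_add' := fun a b => by
        simp only [← insL_apply, map_add, LinearMap.add_apply, GForm.add_apply,
          AlternatingMap.add_apply]
      map_smul' := fun a b => by
        simp only [← insL_apply, map_smul, LinearMap.smul_apply, GForm.smul_apply,
          AlternatingMap.smul_apply, RingHom.id_apply] }
  change ∑ i, θ i x * ev (w i) = ev y
  rw [← h, map_sum]
  simp

theorem sum_mul_insR {ι : Type*} [Fintype ι] {θ : ι → V →ₗ[ℝ] ℝ} {w : ι → V} {x y : V}
    (h : ∑ i, θ i x • w i = y) (f : GForm V) (k ℓ : ℕ) (v : Fin k → V) (u : Fin ℓ → V) :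
    ∑ i, θ i x * f k (ℓ + 1) v (Matrix.vecCons (w i) u) = f k (ℓ + 1) v (Matrix.vecCons y u) := by
  let ev : V →ₗ[ℝ] ℝ :=
    { toFun := fun w => f k (ℓ + 1) v (Matrix.vecCons w u)
      map_add' := fun a b => by
        simp only [← insR_apply, map_add, LinearMap.add_apply, GForm.add_apply,
          AlternatingMap.add_apply]
      map_smul' := fun a b => by
        simp only [← insR_apply, map_smul, LinearMap.smul_apply, GForm.smul_apply,
          AlternatingMap.smul_apply, RingHom.id_apply] }
  change ∑ i, θ i x * ev (w i) = ev y
  rw [← h, map_sum]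
  simp

theorem GForm.apply_sum {ι : Type*} (s : Finset ι) (f : ι → GForm V) (k ℓ : ℕ) (v : Fin k → V)
    (u : Fin ℓ → V) : (∑ i ∈ s, f i) k ℓ v u = ∑ i ∈ s, f i k ℓ v u := by
  let ev : GForm V →+ ℝ :=
    { toFun := fun f => f k ℓ v u, map_zero' := rfl, map_add' := fun _ _ => rfl }
  exact map_sum ev f s

theorem cons_removeNth_left (f : GForm V) (k ℓ : ℕ) (v : Fin (k + 1) → V) (u : Fin ℓ → V)
    (j : Fin (k + 1)) :
    (-1 : ℝ) ^ (j : ℕ) * f (k + 1) ℓ (Matrix.vecCons (v j) (j.removeNth v)) u =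
      f (k + 1) ℓ v u := by
  rw [← AlternatingMap.neg_one_pow_smul_map_insertNth, Fin.insertNth_self_removeNth]
  rcases Nat.even_or_odd (j : ℕ) with h | h <;> simp [h.neg_one_pow]

theorem cons_removeNth_right (f : GForm V) (k ℓ : ℕ) (v : Fin k → V) (u : Fin (ℓ + 1) → V)
    (j : Fin (ℓ + 1)) :
    (-1 : ℝ) ^ (j : ℕ) * f k (ℓ + 1) v (Matrix.vecCons (u j) (j.removeNth u)) =
      f k (ℓ + 1) v u := by
  rw [← AlternatingMap.neg_one_pow_smul_map_insertNth, Fin.insertNth_self_removeNth]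
  rcases Nat.even_or_odd (j : ℕ) with h | h <;> simp [h.neg_one_pow]

variable {U : Type*} [AddCommGroup U] [Module ℝ U] {ι : Type*} [Fintype ι] {θ : ι → V →ₗ[ℝ] ℝ}
  {w : ι → V}

/-- Only the resolution of the identity by θ and w is needed, not that they are bases. This matters
later for an overcomplete family in a hyperplane. -/
theorem sum_wedR_insL (h : ∀ x, ∑ i, θ i x • w i = x) (f : GForm V) :
    ∑ i, wedR (θ i) (insL (w i) f) = gSd f := by
  refine GForm.ext_apply fun k ℓ v u => ?_
  rw [GForm.apply_sum]
  cases ℓ with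
  | zero => simp [wedR_zero, gSd_zero]
  | succ ℓ =>
    simp only [wedR_apply, gSd_apply]
    rw [Finset.sum_comm]
    refine Finset.sum_congr rfl fun j _ => ?_
    rw [← Finset.mul_sum]
    exact congrArg _ (sum_mul_insL (h (u j)) f k ℓ v (j.removeNth u))

theorem sum_wedL_insR (h : ∀ x, ∑ i, θ i x • w i = x) (f : GForm V) :
    ∑ i, wedL (θ i) (insR (w i) f) = gS f := by
  refine GForm.ext_apply fun k ℓ v u => ?_
  rw [GForm.apply_sum]
  cases k with
  | zero => simp [wedL_zero, gS_zero]
  | succ k =>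
    simp only [wedL_apply, gS_apply]
    rw [Finset.sum_comm]
    refine Finset.sum_congr rfl fun j _ => ?_
    rw [← Finset.mul_sum]
    exact congrArg _ (sum_mul_insR (h (v j)) f k ℓ (j.removeNth v) u)

theorem sum_wedL_insL (h : ∀ x, ∑ i, θ i x • w i = x) (f : GForm V) :
    ∑ i, wedL (θ i) (insL (w i) f) = degL f := by
  refine GForm.ext_apply fun k ℓ v u => ?_
  rw [GForm.apply_sum]
  cases k with
  | zero => simp [wedL_zero, degL_apply]
  | succ k =>
    simp only [wedL_apply, degL_apply]
    rw [Finset.sum_comm]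
    have : ∀ j ∈ (Finset.univ : Finset (Fin (k + 1))), ∑ i, (-1 : ℝ) ^ (j : ℕ) *
        (θ i (v j) * insL (w i) f k ℓ (j.removeNth v) u) = f (k + 1) ℓ v u := fun j _ => by
      rw [← Finset.mul_sum, ← cons_removeNth_left f k ℓ v u j]
      exact congrArg _ (sum_mul_insL (h (v j)) f k ℓ (j.removeNth v) u)
    rw [Finset.sum_congr rfl this]
    simp

theorem sum_wedR_insR (h : ∀ x, ∑ i, θ i x • w i = x) (f : GForm V) :
    ∑ i, wedR (θ i) (insR (w i) f) = degR f := by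
  refine GForm.ext_apply fun k ℓ v u => ?_
  rw [GForm.apply_sum]
  cases ℓ with
  | zero => simp [wedR_zero, degR_apply]
  | succ ℓ =>
    simp only [wedR_apply, degR_apply]
    rw [Finset.sum_comm]
    have : ∀ j ∈ (Finset.univ : Finset (Fin (ℓ + 1))), ∑ i, (-1 : ℝ) ^ (j : ℕ) *
        (θ i (u j) * insR (w i) f k ℓ v (j.removeNth u)) = f k (ℓ + 1) v u := fun j _ => by
      rw [← Finset.mul_sum, ← cons_removeNth_right f k ℓ v u j]
      exact congrArg _ (sum_mul_insR (h (u j)) f k ℓ v (j.removeNth u))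
    rw [Finset.sum_congr rfl this]
    simp

theorem gPull_insL (g : U →ₗ[ℝ] V) (x : U) (f : GForm V) :
    gPull g (insL (g x) f) = insL x (gPull g f) := by
  refine GForm.ext_apply fun k ℓ v u => ?_
  change f (k + 1) ℓ (Matrix.vecCons (g x) fun i => g (v i)) _ = f (k + 1) ℓ (fun i => g _) _
  congr 2
  ext i
  refine Fin.cases ?_ (fun i => ?_) i <;> simp

theorem gPull_insR (g : U →ₗ[ℝ] V) (x : U) (f : GForm V) :
    gPull g (insR (g x) f) = insR x (gPull g f) := by
  refine GForm.ext_apply fun k ℓ v u => ?_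
  change f k (ℓ + 1) _ (Matrix.vecCons (g x) fun i => g (u i)) = f k (ℓ + 1) _ (fun i => g _)
  congr 1
  ext i
  refine Fin.cases ?_ (fun i => ?_) i <;> simp

theorem gPull_wedL (g : U →ₗ[ℝ] V) (η : V →ₗ[ℝ] ℝ) (f : GForm V) :
    gPull g (wedL η f) = wedL (η ∘ₗ g) (gPull g f) := by
  refine GForm.ext_apply fun k ℓ v u => ?_
  cases k with
  | zero => rfl
  | succ k =>
    rw [gPull_apply, pullback_apply, wedL_apply, wedL_apply]
    rfl

theorem gPull_wedR (g : U →ₗ[ℝ] V) (η : V →ₗ[ℝ] ℝ) (f : GForm V) :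
    gPull g (wedR η f) = wedR (η ∘ₗ g) (gPull g f) := by
  refine GForm.ext_apply fun k ℓ v u => ?_
  cases ℓ with
  | zero => rfl
  | succ k =>
    rw [gPull_apply, pullback_apply, wedR_apply, wedR_apply]
    rfl

theorem gPull_gS (g : U →ₗ[ℝ] V) (f : GForm V) : gPull g (gS f) = gS (gPull g f) := by
  refine GForm.ext_apply fun k ℓ v u => ?_
  cases k with
  | zero => rfl
  | succ k =>
    rw [gPull_apply, pullback_apply, gS_apply, gS_apply]
    refine Finset.sum_congr rfl fun j _ => congrArg _ ?_
    rw [gPull_apply, pullback_apply]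
    congr 1
    ext i
    refine Fin.cases ?_ (fun i => ?_) i <;> simp

theorem gPull_gSd (g : U →ₗ[ℝ] V) (f : GForm V) : gPull g (gSd f) = gSd (gPull g f) := by
  refine GForm.ext_apply fun k ℓ v u => ?_
  cases ℓ with
  | zero => rfl
  | succ k =>
    rw [gPull_apply, pullback_apply, gSd_apply, gSd_apply]
    refine Finset.sum_congr rfl fun j _ => congrArg _ ?_
    rw [gPull_apply, pullback_apply]
    congr 2
    ext i
    refine Fin.cases ?_ (fun i => ?_) i <;> simp

theorem gPull_degL (g : U →ₗ[ℝ] V) (f : GForm V) : gPull g (degL f) = degL (gPull g f) := rfl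

theorem gPull_degR (g : U →ₗ[ℝ] V) (f : GForm V) : gPull g (degR f) = degR (gPull g f) := rfl

theorem gSd_eq_sum
    (h : ∀ x, ∑ i, θ i x • w i = x) : gSd = ∑ i, wedR (θ i) * insL (w i) := by
  refine LinearMap.ext fun f => ?_
  rw [LinearMap.sum_apply]
  exact (sum_wedR_insL h f).symm

theorem gS_eq_sum
    (h : ∀ x, ∑ i, θ i x • w i = x) : gS = ∑ i, wedL (θ i) * insR (w i) := by
  refine LinearMap.ext fun f => ?_
  rw [LinearMap.sum_apply]
  exact (sum_wedL_insR h f).symm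

theorem degL_eq_sum
    (h : ∀ x, ∑ i, θ i x • w i = x) : degL = ∑ i, wedL (θ i) * insL (w i) := by
  refine LinearMap.ext fun f => ?_
  rw [LinearMap.sum_apply]
  exact (sum_wedL_insL h f).symm

theorem degR_eq_sum
    (h : ∀ x, ∑ i, θ i x • w i = x) : degR = ∑ i, wedR (θ i) * insR (w i) := by
  refine LinearMap.ext fun f => ?_
  rw [LinearMap.sum_apply]
  exact (sum_wedR_insR h f).symm

end Expansion

/-! ### Commutation relations of the connecting maps. -/

section Relations

variable {V : Type*} [AddCommGroup V] [Module ℝ V] [FiniteDimensional ℝ V]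

theorem exists_dual_family (V : Type*) [AddCommGroup V] [Module ℝ V] [FiniteDimensional ℝ V] :
    ∃ (n : ℕ) (θ : Fin n → V →ₗ[ℝ] ℝ) (w : Fin n → V), ∀ x, ∑ i, θ i x • w i = x :=
  ⟨_, (Module.finBasis ℝ V).coord, Module.finBasis ℝ V, fun x => (Module.finBasis ℝ V).sum_repr x⟩

theorem gSd_mul_insL (x : V) : gSd * insL x = -(insL x * gSd) := by
  obtain ⟨n, θ, w, h⟩ := exists_dual_family V
  rw [gSd_eq_sum h, Finset.sum_mul, Finset.mul_sum, ← Finset.sum_neg_distrib]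
  refine Finset.sum_congr rfl fun i _ => ?_
  rw [mul_assoc, insL_anticomm, ← mul_assoc, insL_mul_wedR]
  noncomm_ring

theorem insR_mul_gSd (x : V) : insR x * gSd = insL x - gSd * insR x := by
  obtain ⟨n, θ, w, h⟩ := exists_dual_family V
  have hx : insL x = ∑ i, θ i x • insL (w i) := by
    conv_lhs => rw [← h x]
    simp [map_sum]
  rw [gSd_eq_sum h, Finset.sum_mul, Finset.mul_sum, hx, ← Finset.sum_sub_distrib]
  refine Finset.sum_congr rfl fun i _ => ?_
  rw [← mul_assoc, insR_mul_wedR, sub_mul, smul_mul_assoc, one_mul, mul_assoc, mul_assoc,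
    insL_mul_insR]

theorem gSd_mul_wedL (η : V →ₗ[ℝ] ℝ) : gSd * wedL η = wedR η - wedL η * gSd := by
  obtain ⟨n, θ, w, h⟩ := exists_dual_family V
  have hx : wedR η = ∑ i, η (w i) • wedR (θ i) := by
    have : η = ∑ i, η (w i) • θ i := by
      ext x
      conv_lhs => rw [← h x]
      simp [mul_comm]
    conv_lhs => rw [this]
    simp [map_sum]
  rw [gSd_eq_sum h, Finset.sum_mul, Finset.mul_sum, hx, ← Finset.sum_sub_distrib]
  refine Finset.sum_congr rfl fun i _ => ?_
  rw [mul_assoc, insL_mul_wedL, mul_sub, mul_smul_comm, mul_one, ← mul_assoc, ← mul_assoc,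
    wedL_mul_wedR]

theorem gSd_mul_wedR (η : V →ₗ[ℝ] ℝ) : gSd * wedR η = -(wedR η * gSd) := by
  obtain ⟨n, θ, w, h⟩ := exists_dual_family V
  rw [gSd_eq_sum h, Finset.sum_mul, Finset.mul_sum, ← Finset.sum_neg_distrib]
  refine Finset.sum_congr rfl fun i _ => ?_
  rw [mul_assoc, insL_mul_wedR, ← mul_assoc, wedR_anticomm]
  noncomm_ring

/-- The sl₂ relation. In each summand λ ∧ (w ⌟ ·) of `gS`, moving `gSd` to the left turns the
contraction into one in the first factor and the product into one in the second. The two defects sum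
to the two degree operators. -/
theorem gS_mul_gSd : (gS * gSd : Module.End ℝ (GForm V)) = gSd * gS + (degL - degR) := by
  obtain ⟨n, θ, w, h⟩ := exists_dual_family V
  have h1 : ∀ η : V →ₗ[ℝ] ℝ, gSd * wedL η = wedR η - wedL η * gSd := gSd_mul_wedL
  rw [gS_eq_sum h, Finset.sum_mul, Finset.mul_sum, degL_eq_sum h, degR_eq_sum h,
    ← Finset.sum_sub_distrib, ← Finset.sum_add_distrib]
  refine Finset.sum_congr rfl fun i _ => ?_
  rw [mul_assoc, insR_mul_gSd, ← mul_assoc, gSd_mul_wedL]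
  noncomm_ring

end Relations

section FormArithmetic

variable {V : Type*} [AddCommGroup V] [Module ℝ V] {k ℓ : ℕ}

theorem Form.sub_smul (a b : ℝ) (ω : Form V k ℓ) : (a - b) • ω = a • ω - b • ω :=
  _root_.sub_smul a b ω

theorem Form.sub_self (ω : Form V k ℓ) : ω - ω = 0 := _root_.sub_self ω

theorem Form.sub_eq_zero {ω η : Form V k ℓ} : ω - η = 0 ↔ ω = η :=
  _root_.sub_eq_zero (a := ω) (b := η)

theorem Form.add_sub_cancel_right (ω η : Form V k ℓ) : ω + η - η = ω :=
  _root_.add_sub_cancel_right ω η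

theorem Form.smul_eq_zero {c : ℝ} {ω : Form V k ℓ} : c • ω = 0 ↔ c = 0 ∨ ω = 0 :=
  _root_.smul_eq_zero

end FormArithmetic

/-! ### Homogeneous forms, and passage between graded operators and the iterates in fixed degree. -/

section Degree

variable {V : Type*} [AddCommGroup V] [Module ℝ V]

/-- `f` is homogeneous of degree `(a, b)`. -/
def IsDeg (a b : ℝ) (f : GForm V) : Prop := degL f = a • f ∧ degR f = b • f

theorem IsDeg.zero (a b : ℝ) : IsDeg a b (0 : GForm V) := by simp [IsDeg]

theorem IsDeg.add {a b : ℝ} {f g : GForm V} (hf : IsDeg a b f) (hg : IsDeg a b g) :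
    IsDeg a b (f + g) :=
  ⟨by rw [map_add, hf.1, hg.1, smul_add], by rw [map_add, hf.2, hg.2, smul_add]⟩

theorem IsDeg.sub {a b : ℝ} {f g : GForm V} (hf : IsDeg a b f) (hg : IsDeg a b g) :
    IsDeg a b (f - g) :=
  ⟨by rw [map_sub, hf.1, hg.1, smul_sub], by rw [map_sub, hf.2, hg.2, smul_sub]⟩

/-- Degrees are real numbers, so lowering a degree is never truncated and forms of negative degree
vanish automatically. -/
theorem IsDeg.apply_eq_zero {a b : ℝ} {f : GForm V} (hf : IsDeg a b f) {k ℓ : ℕ}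
    (h : (k : ℝ) ≠ a ∨ (ℓ : ℝ) ≠ b) : f k ℓ = 0 := by
  rcases h with h | h
  · have h1 : (k : ℝ) • f k ℓ = a • f k ℓ := GForm.congr_apply hf.1 k ℓ
    rw [← Form.sub_eq_zero, ← Form.sub_smul] at h1
    exact (Form.smul_eq_zero.1 h1).resolve_left (sub_ne_zero.2 h)
  · have h1 : (ℓ : ℝ) • f k ℓ = b • f k ℓ := GForm.congr_apply hf.2 k ℓ
    rw [← Form.sub_eq_zero, ← Form.sub_smul] at h1
    exact (Form.smul_eq_zero.1 h1).resolve_left (sub_ne_zero.2 h)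

theorem IsDeg.eq_zero {k ℓ : ℕ} {f : GForm V} (hf : IsDeg k ℓ f) (h : f k ℓ = 0) : f = 0 := by
  refine GForm.ext fun k' ℓ' => ?_
  by_cases hk : k' = k
  · by_cases hl : ℓ' = ℓ
    · subst hk hl; exact h
    · exact hf.apply_eq_zero (Or.inr (by exact_mod_cast hl))
  · exact hf.apply_eq_zero (Or.inl (by exact_mod_cast hk))

theorem IsDeg.ext {k ℓ : ℕ} {f g : GForm V} (hf : IsDeg k ℓ f) (hg : IsDeg k ℓ g)
    (h : f k ℓ = g k ℓ) : f = g :=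
  sub_eq_zero.1 ((hf.sub hg).eq_zero (by rw [GForm.sub_apply, h, Form.sub_self]))

theorem IsDeg.insL {a b : ℝ} {f : GForm V} (hf : IsDeg a b f) (w : V) :
    IsDeg (a - 1) b (insL w f) := by
  refine ⟨GForm.ext fun k ℓ => ?_, GForm.ext fun k ℓ => ?_⟩
  · have h1 : ((k + 1 : ℕ) : ℝ) • f (k + 1) ℓ = a • f (k + 1) ℓ := GForm.congr_apply hf.1 _ ℓ
    have h2 := congrArg (fun α => AlternatingMap.curryLeft α w) h1
    change ((k + 1 : ℕ) : ℝ) • FormValued.insL w f k ℓ = a • FormValued.insL w f k ℓ at h2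
    rw [degL_apply, GForm.smul_apply, Form.sub_smul, ← h2]
    push_cast
    rw [add_smul, one_smul, Form.add_sub_cancel_right]
  · exact congrArg (fun α => AlternatingMap.curryLeft α w) (GForm.congr_apply hf.2 (k + 1) ℓ)

theorem IsDeg.insR {a b : ℝ} {f : GForm V} (hf : IsDeg a b f) (w : V) :
    IsDeg a (b - 1) (insR w f) := by
  refine ⟨GForm.ext fun k ℓ => ?_, GForm.ext fun k ℓ => ?_⟩
  · exact congrArg (fun α => insertSnd α w) (GForm.congr_apply hf.1 k (ℓ + 1))
  · have h1 : ((ℓ + 1 : ℕ) : ℝ) • f k (ℓ + 1) = b • f k (ℓ + 1) := GForm.congr_apply hf.2 _ _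
    have h2 := congrArg (fun α => insertSnd α w) h1
    change ((ℓ + 1 : ℕ) : ℝ) • FormValued.insR w f k ℓ = b • FormValued.insR w f k ℓ at h2
    rw [degR_apply, GForm.smul_apply, Form.sub_smul, ← h2]
    push_cast
    rw [add_smul, one_smul, Form.add_sub_cancel_right]

theorem IsDeg.gPull {U : Type*} [AddCommGroup U] [Module ℝ U] (g : U →ₗ[ℝ] V) {a b : ℝ}
    {f : GForm V} (hf : IsDeg a b f) : IsDeg a b (gPull g f) :=
  ⟨by rw [← gPull_degL, hf.1, map_smul], by rw [← gPull_degR, hf.2, map_smul]⟩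

theorem IsDeg.gS {a b : ℝ} {f : GForm V} (hf : IsDeg a b f) : IsDeg (a + 1) (b - 1) (gS f) := by
  refine ⟨GForm.ext fun k ℓ => ?_, GForm.ext fun k ℓ => ?_⟩
  · cases k with
    | zero =>
      exact (smul_zero (A := Form V 0 ℓ) ((0 : ℕ) : ℝ)).trans (smul_zero (A := Form V 0 ℓ) (a + 1)).symm
    | succ k =>
      have h1 := congrArg (connS V k (ℓ + 1)) (GForm.congr_apply hf.1 k (ℓ + 1))
      rw [degL_apply, GForm.smul_apply, map_smul, map_smul] at h1
      change ((k + 1 : ℕ) : ℝ) • connS V k (ℓ + 1) (f k (ℓ + 1)) =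
        (a + 1) • connS V k (ℓ + 1) (f k (ℓ + 1))
      push_cast
      rw [add_smul, add_smul, h1]
  · cases k with
    | zero =>
      exact (smul_zero (A := Form V 0 ℓ) (ℓ : ℝ)).trans (smul_zero (A := Form V 0 ℓ) (b - 1)).symm
    | succ k =>
      have h1 := congrArg (connS V k (ℓ + 1)) (GForm.congr_apply hf.2 k (ℓ + 1))
      rw [degR_apply, GForm.smul_apply, map_smul, map_smul] at h1
      change (ℓ : ℝ) • connS V k (ℓ + 1) (f k (ℓ + 1)) =
        (b - 1) • connS V k (ℓ + 1) (f k (ℓ + 1))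
      push_cast at h1
      rw [Form.sub_smul, ← h1, add_smul, one_smul, Form.add_sub_cancel_right]

theorem IsDeg.gSd {a b : ℝ} {f : GForm V} (hf : IsDeg a b f) : IsDeg (a - 1) (b + 1) (gSd f) := by
  refine ⟨GForm.ext fun k ℓ => ?_, GForm.ext fun k ℓ => ?_⟩
  · cases ℓ with
    | zero =>
      exact (smul_zero (A := Form V k 0) (k : ℝ)).trans (smul_zero (A := Form V k 0) (a - 1)).symm
    | succ ℓ =>
      have h1 := congrArg (connSDag V (k + 1) ℓ) (GForm.congr_apply hf.1 (k + 1) ℓ)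
      rw [degL_apply, GForm.smul_apply, map_smul, map_smul] at h1
      change (k : ℝ) • connSDag V (k + 1) ℓ (f (k + 1) ℓ) =
        (a - 1) • connSDag V (k + 1) ℓ (f (k + 1) ℓ)
      push_cast at h1
      rw [Form.sub_smul, ← h1, add_smul, one_smul, Form.add_sub_cancel_right]
  · cases ℓ with
    | zero =>
      exact (smul_zero (A := Form V k 0) ((0 : ℕ) : ℝ)).trans (smul_zero (A := Form V k 0) (b + 1)).symm
    | succ ℓ =>
      have h1 := congrArg (connSDag V (k + 1) ℓ) (GForm.congr_apply hf.2 (k + 1) ℓ)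
      rw [degR_apply, GForm.smul_apply, map_smul, map_smul] at h1
      change ((ℓ + 1 : ℕ) : ℝ) • connSDag V (k + 1) ℓ (f (k + 1) ℓ) =
        (b + 1) • connSDag V (k + 1) ℓ (f (k + 1) ℓ)
      push_cast
      rw [add_smul, add_smul, h1]

theorem IsDeg.gS_pow {a b : ℝ} {f : GForm V} (hf : IsDeg a b f) (j : ℕ) :
    IsDeg (a + j) (b - j) ((FormValued.gS ^ j) f) := by
  induction j with
  | zero => simpa using hf
  | succ j ih =>
    rw [pow_succ_apply']
    convert ih.gS using 1 <;> push_cast <;> ring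

theorem IsDeg.gSd_pow {a b : ℝ} {f : GForm V} (hf : IsDeg a b f) (j : ℕ) :
    IsDeg (a - j) (b + j) ((FormValued.gSd ^ j) f) := by
  induction j with
  | zero => simpa using hf
  | succ j ih =>
    rw [pow_succ_apply']
    convert ih.gSd using 1 <;> push_cast <;> ring

/-- The homogeneous form with a given component. -/
def gSingle (k ℓ : ℕ) : Form V k ℓ →ₗ[ℝ] GForm V :=
  gLift fun k' ℓ' =>
    if h : k = k' ∧ ℓ = ℓ' then degreeCast V h.1 h.2 else 0

theorem gSingle_same (k ℓ : ℕ) (ω : Form V k ℓ) : gSingle k ℓ ω k ℓ = ω := by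
  change (if h : k = k ∧ ℓ = ℓ then degreeCast V h.1 h.2 else 0 : Form V k ℓ →ₗ[ℝ] Form V k ℓ) ω = ω
  rw [dif_pos ⟨rfl, rfl⟩]
  ext v u
  rfl

theorem gSingle_of_ne {k ℓ k' ℓ' : ℕ} (ω : Form V k ℓ) (h : k' ≠ k ∨ ℓ' ≠ ℓ) :
    gSingle k ℓ ω k' ℓ' = 0 := by
  change (if h : k = k' ∧ ℓ = ℓ' then degreeCast V h.1 h.2 else 0 :
    Form V k ℓ →ₗ[ℝ] Form V k' ℓ') ω = 0
  rw [dif_neg (by omega)]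
  rfl

theorem isDeg_gSingle (k ℓ : ℕ) (ω : Form V k ℓ) : IsDeg k ℓ (gSingle k ℓ ω) := by
  refine ⟨GForm.ext fun k' ℓ' => ?_, GForm.ext fun k' ℓ' => ?_⟩
  · rw [degL_apply, GForm.smul_apply]
    by_cases h : k' = k
    · rw [h]
    · rw [gSingle_of_ne ω (Or.inl h), smul_zero, smul_zero]
  · rw [degR_apply, GForm.smul_apply]
    by_cases h : ℓ' = ℓ
    · rw [h]
    · rw [gSingle_of_ne ω (Or.inr h), smul_zero, smul_zero]

theorem IsDeg.eq_gSingle {k ℓ : ℕ} {f : GForm V} (hf : IsDeg k ℓ f) : f = gSingle k ℓ (f k ℓ) :=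
  hf.ext (isDeg_gSingle _ _ _) (gSingle_same _ _ _).symm

/-- The bound p ≤ k ensures that no natural-number subtraction in the iterate is truncated. -/
theorem gSd_pow_apply (f : GForm V) {k ℓ p : ℕ} (h : p ≤ k) :
    (gSd ^ p) f (k - p) (ℓ + p) = iterSDag V k ℓ p (f k ℓ) := by
  induction p with
  | zero => rfl
  | succ p ih =>
    have key : ∀ (g : GForm V) (a b : ℕ), 1 ≤ a →
        gSd g (a - 1) (b + 1) = connSDag V a b (g a b) := by
      intro g a b ha
      cases a with
      | zero => omega
      | succ a => rfl
    rw [pow_succ_apply']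
    change gSd _ (k - p - 1) (ℓ + p + 1) = connSDag V (k - p) (ℓ + p) (iterSDag V k ℓ p (f k ℓ))
    rw [key _ _ _ (by omega), ih (by omega)]

theorem gS_pow_apply (f : GForm V) {k ℓ p : ℕ} (h : p ≤ ℓ) :
    (gS ^ p) f (k + p) (ℓ - p) = iterS V k ℓ p (f k ℓ) := by
  induction p with
  | zero => rfl
  | succ p ih =>
    have key : ∀ (g : GForm V) (a b : ℕ), 1 ≤ b → gS g (a + 1) (b - 1) = connS V a b (g a b) := by
      intro g a b hb
      cases b with
      | zero => omega
      | succ b => rfl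
    rw [pow_succ_apply']
    change gS _ (k + p + 1) (ℓ - p - 1) = connS V (k + p) (ℓ - p) (iterS V k ℓ p (f k ℓ))
    rw [key _ _ _ (by omega), ih (by omega)]

/-- Casts disappear once both sides are read as components of one graded form. -/
theorem degreeCast_apply (f : GForm V) {k ℓ k' ℓ' : ℕ} (hk : k = k') (hℓ : ℓ = ℓ') :
    degreeCast V hk hℓ (f k ℓ) = f k' ℓ' := by
  subst hk hℓ
  ext v u
  rfl

theorem mirrorMap_apply (f : GForm V) {k ℓ s : ℕ} (hsk : s ≤ k) (hkℓ : k ≤ ℓ) :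
    mirrorMap V hsk hkℓ (f (ℓ + s) (k - s)) = (gS ^ s) ((gSd ^ (ℓ - k + 2 * s)) f) k ℓ := by
  simp only [mirrorMap, LinearMap.comp_apply]
  rw [← gSd_pow_apply f (by omega), degreeCast_apply, ← gS_pow_apply _ (by omega), degreeCast_apply]

theorem IsDeg.mem_W_iff {k ℓ p : ℕ} (hp : p ≤ k) {f : GForm V} (hf : IsDeg k ℓ f) :
    f k ℓ ∈ W V k ℓ p ↔ (FormValued.gSd ^ p) f = 0 := by
  rw [W, LinearMap.mem_ker, ← gSd_pow_apply f hp]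
  refine ⟨fun h => IsDeg.eq_zero (k := k - p) (ℓ := ℓ + p) ?_ h, fun h => by rw [h]; rfl⟩
  have := hf.gSd_pow p
  push_cast [hp]
  exact this

theorem mem_W_iff {k ℓ p : ℕ} (hp : p ≤ k) {ω : Form V k ℓ} :
    ω ∈ W V k ℓ p ↔ (gSd ^ p) (gSingle k ℓ ω) = 0 := by
  rw [← (isDeg_gSingle k ℓ ω).mem_W_iff hp, gSingle_same]

theorem gPull_gSingle {U : Type*} [AddCommGroup U] [Module ℝ U] (g : U →ₗ[ℝ] V) {k ℓ : ℕ}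
    (ω : Form V k ℓ) : gPull g (gSingle k ℓ ω) = gSingle k ℓ (pullback g k ℓ ω) :=
  ((isDeg_gSingle k ℓ ω).gPull g).ext (isDeg_gSingle _ _ _)
    (by rw [gPull_apply, gSingle_same, gSingle_same])

theorem gPull_gSd_pow {U : Type*} [AddCommGroup U] [Module ℝ U] (g : U →ₗ[ℝ] V) (p : ℕ)
    (f : GForm V) : gPull g ((gSd ^ p) f) = (gSd ^ p) (gPull g f) := by
  induction p with
  | zero => rfl
  | succ p ih => rw [pow_succ_apply', gPull_gSd, ih, ← pow_succ_apply']

theorem gPull_gS_pow {U : Type*} [AddCommGroup U] [Module ℝ U] (g : U →ₗ[ℝ] V) (p : ℕ)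
    (f : GForm V) : gPull g ((gS ^ p) f) = (gS ^ p) (gPull g f) := by
  induction p with
  | zero => rfl
  | succ p ih => rw [pow_succ_apply', gPull_gS, ih, ← pow_succ_apply']

theorem pullback_mem_W {U : Type*} [AddCommGroup U] [Module ℝ U] (g : U →ₗ[ℝ] V) {k ℓ p : ℕ}
    (hp : p ≤ k) {ω : Form V k ℓ} (h : ω ∈ W V k ℓ p) : pullback g k ℓ ω ∈ W U k ℓ p := by
  rw [mem_W_iff hp] at h ⊢
  rw [← gPull_gSingle, ← gPull_gSd_pow, h, map_zero]

theorem gS_pow_eq_zero {k ℓ : ℕ} {f : GForm V} (hf : IsDeg k ℓ f) : (gS ^ (ℓ + 1)) f = 0 := by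
  have h := hf.gS_pow (ℓ + 1)
  refine GForm.ext fun k' ℓ' => h.apply_eq_zero (Or.inr ?_)
  push_cast
  have : (0 : ℝ) ≤ ℓ' := by positivity
  linarith

end Degree

/-! ### The weight operator and its commutators. -/

section Weights

variable {V : Type*} [AddCommGroup V] [Module ℝ V]

theorem gS_gSd [FiniteDimensional ℝ V] (f : GForm V) :
    gS (gSd f) = gSd (gS f) + (degL - degR : Module.End ℝ (GForm V)) f :=
  LinearMap.congr_fun gS_mul_gSd f

theorem weight_gS (f : GForm V) :
    (degL - degR : Module.End ℝ (GForm V)) (gS f) =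
      gS ((degL - degR : Module.End ℝ (GForm V)) f) + (2 : ℝ) • gS f := by
  refine GForm.ext fun k ℓ => ?_
  cases k with
  | zero =>
    change (_ : ℝ) • (0 : Form V _ _) - (_ : ℝ) • (0 : Form V _ _) = 0 + (_ : ℝ) • (0 : Form V _ _)
    rw [smul_zero, smul_zero, smul_zero, Form.sub_self, zero_add]
  | succ k =>
    change ((k + 1 : ℕ) : ℝ) • connS V k (ℓ + 1) (f k (ℓ + 1)) -
      (ℓ : ℝ) • connS V k (ℓ + 1) (f k (ℓ + 1)) =
      connS V k (ℓ + 1) ((k : ℝ) • f k (ℓ + 1) - ((ℓ + 1 : ℕ) : ℝ) • f k (ℓ + 1)) +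
        (2 : ℝ) • connS V k (ℓ + 1) (f k (ℓ + 1))
    rw [← Form.sub_smul, ← Form.sub_smul, map_smul, ← add_smul]
    congr 1
    push_cast
    ring

theorem weight_gSd (f : GForm V) :
    (degL - degR : Module.End ℝ (GForm V)) (gSd f) =
      gSd ((degL - degR : Module.End ℝ (GForm V)) f) + (-2 : ℝ) • gSd f := by
  refine GForm.ext fun k ℓ => ?_
  cases ℓ with
  | zero =>
    change (_ : ℝ) • (0 : Form V _ _) - (_ : ℝ) • (0 : Form V _ _) = 0 + (_ : ℝ) • (0 : Form V _ _)
    rw [smul_zero, smul_zero, smul_zero, Form.sub_self, zero_add]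
  | succ ℓ =>
    change (k : ℝ) • connSDag V (k + 1) ℓ (f (k + 1) ℓ) -
      ((ℓ + 1 : ℕ) : ℝ) • connSDag V (k + 1) ℓ (f (k + 1) ℓ) =
      connSDag V (k + 1) ℓ (((k + 1 : ℕ) : ℝ) • f (k + 1) ℓ - (ℓ : ℝ) • f (k + 1) ℓ) +
        (-2 : ℝ) • connSDag V (k + 1) ℓ (f (k + 1) ℓ)
    rw [← Form.sub_smul, ← Form.sub_smul, map_smul, ← add_smul]
    congr 1
    push_cast
    ring

theorem IsDeg.weight {a b : ℝ} {f : GForm V} (hf : IsDeg a b f) :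
    (degL - degR : Module.End ℝ (GForm V)) f = (a - b) • f := by
  rw [LinearMap.sub_apply, hf.1, hf.2, sub_smul]

end Weights

/-! ### Forms determined by a hyperplane and a transverse vector. -/

section Vanishing

variable {V M : Type*} [AddCommGroup V] [Module ℝ V] [AddCommGroup M] [Module ℝ M]

/-- Each argument splits as s(v)e plus a vector of ker s. The induction enlarges the set of
arguments allowed to lie outside ker s. -/
theorem alternatingMap_eq_zero_of_forall_mem_ker {n : ℕ} {s : V →ₗ[ℝ] ℝ} {e : V} (hs : s e = 1)
    (α : V [⋀^Fin n]→ₗ[ℝ] M) (hT : ∀ v : Fin n → V, (∀ i, s (v i) = 0) → α v = 0)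
    (he : ∀ (v : Fin n → V) (i : Fin n), v i = e → α v = 0) : α = 0 := by
  have key : ∀ (A : Finset (Fin n)) (v : Fin n → V), (∀ i, i ∉ A → s (v i) = 0) → α v = 0 := by
    intro A
    induction A using Finset.induction_on with
    | empty => exact fun v hv => hT v fun i => hv i (by simp)
    | insert a A ha ih =>
      intro v hv
      have h1 : v a = s (v a) • e + (v a - s (v a) • e) := by abel
      rw [← Function.update_eq_self a v, h1, AlternatingMap.map_update_add,
        AlternatingMap.map_update_smul, he _ a (by simp), smul_zero, zero_add]
      refine ih _ fun i hi => ?_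
      by_cases hia : i = a
      · subst hia
        simp [hs]
      · rw [Function.update_of_ne hia]
        exact hv i (by simp [hia, hi])
  ext v
  exact key Finset.univ v fun i hi => absurd (Finset.mem_univ i) hi

theorem alternatingMap_succ_eq_zero {n : ℕ} {s : V →ₗ[ℝ] ℝ} {e : V} (hs : s e = 1)
    (α : V [⋀^Fin (n + 1)]→ₗ[ℝ] M) (hT : ∀ v : Fin (n + 1) → V, (∀ i, s (v i) = 0) → α v = 0)
    (he : ∀ v : Fin n → V, (∀ i, s (v i) = 0) → α (Matrix.vecCons e v) = 0) : α = 0 := by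
  have h0 : α.curryLeft e = 0 := by
    refine alternatingMap_eq_zero_of_forall_mem_ker hs _ he fun v i hi => ?_
    refine α.map_eq_zero_of_eq (i := 0) (j := i.succ) _ ?_ (Fin.succ_ne_zero i).symm
    simp [hi]
  refine alternatingMap_eq_zero_of_forall_mem_ker hs _ hT fun v i hi => ?_
  have h1 := AlternatingMap.map_insertNth α i e (i.removeNth v)
  rw [← hi, Fin.insertNth_self_removeNth, hi] at h1
  have h2 : α (Matrix.vecCons e (i.removeNth v)) = 0 :=
    congrArg (fun β : V [⋀^Fin n]→ₗ[ℝ] M => β (i.removeNth v)) h0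
  rw [h1, h2, smul_zero]

/-- With V = ker s ⊕ ℝe, each factor either has no e among its arguments or exactly one, which can
be moved to the front. This gives four components. -/
theorem gForm_eq_zero_of_ker {s : V →ₗ[ℝ] ℝ} {e : V} (hs : s e = 1) {f : GForm V}
    (h0 : gPull (LinearMap.ker s).subtype f = 0)
    (h1 : gPull (LinearMap.ker s).subtype (insL e f) = 0)
    (h2 : gPull (LinearMap.ker s).subtype (insR e f) = 0)
    (h3 : gPull (LinearMap.ker s).subtype (insL e (insR e f)) = 0) : f = 0 := by
  have lift : ∀ {g : GForm V}, gPull (LinearMap.ker s).subtype g = 0 → ∀ {k ℓ : ℕ} (v : Fin k → V)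
      (u : Fin ℓ → V), (∀ i, s (v i) = 0) → (∀ i, s (u i) = 0) → g k ℓ v u = 0 := by
    intro g hg k ℓ v u hv hu
    have h := GForm.congr_apply hg k ℓ
    exact congrArg (fun α : Form (LinearMap.ker s) k ℓ =>
      α (fun i => ⟨v i, hv i⟩) (fun i => ⟨u i, hu i⟩)) h
  refine GForm.ext fun k ℓ => ?_
  rw [GForm.zero_apply]
  have step : ∀ {g : GForm V}, gPull (LinearMap.ker s).subtype g = 0 →
      gPull (LinearMap.ker s).subtype (insR e g) = 0 → ∀ {k : ℕ} (v : Fin k → V),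
      (∀ i, s (v i) = 0) → g k ℓ v = 0 := by
    intro g hg hg' k v hv
    cases ℓ with
    | zero =>
      ext u
      exact lift hg v u hv fun i => i.elim0
    | succ ℓ =>
      exact alternatingMap_succ_eq_zero hs _ (fun u hu => lift hg v u hv hu)
        fun u hu => lift hg' v u hv hu
  cases k with
  | zero => exact AlternatingMap.ext fun v => step h0 h2 v fun i => i.elim0
  | succ k =>
    exact alternatingMap_succ_eq_zero hs _ (fun v hv => step h0 h2 v hv)
      fun v hv => step (g := insL e f) h1 (by rwa [← Module.End.mul_apply, ← insL_mul_insR]) v hv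

end Vanishing

/-! ### The operator `diagOp`: invariance and naturality. -/

section Polarization

variable {V : Type*} [AddCommGroup V] [Module ℝ V]

theorem IsDeg.wedL {a b : ℝ} {f : GForm V} (hf : IsDeg a b f) (η : V →ₗ[ℝ] ℝ) :
    IsDeg (a + 1) b (wedL η f) := by
  refine ⟨GForm.ext fun k ℓ => ?_, GForm.ext fun k ℓ => ?_⟩
  · cases k with
    | zero =>
      exact (smul_zero (A := Form V 0 ℓ) ((0 : ℕ) : ℝ)).trans (smul_zero (A := Form V 0 ℓ) (a + 1)).symm
    | succ k =>
      have h1 := congrArg (wedgeOne k η) (GForm.congr_apply hf.1 k ℓ)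
      rw [degL_apply, GForm.smul_apply, map_smul, map_smul] at h1
      change ((k + 1 : ℕ) : ℝ) • wedgeOne k η (f k ℓ) = (a + 1) • wedgeOne k η (f k ℓ)
      push_cast
      rw [add_smul, add_smul, h1]
  · cases k with
    | zero =>
      exact (smul_zero (A := Form V 0 ℓ) (ℓ : ℝ)).trans (smul_zero (A := Form V 0 ℓ) b).symm
    | succ k =>
      have h1 := congrArg (wedgeOne k η) (GForm.congr_apply hf.2 k ℓ)
      rwa [degR_apply, GForm.smul_apply, map_smul, map_smul] at h1

theorem IsDeg.wedR {a b : ℝ} {f : GForm V} (hf : IsDeg a b f) (η : V →ₗ[ℝ] ℝ) :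
    IsDeg a (b + 1) (wedR η f) := by
  refine ⟨GForm.ext fun k ℓ => ?_, GForm.ext fun k ℓ => ?_⟩
  · cases ℓ with
    | zero =>
      exact (smul_zero (A := Form V k 0) (k : ℝ)).trans (smul_zero (A := Form V k 0) a).symm
    | succ ℓ =>
      have h1 := congrArg (mapSnd k (wedgeOne ℓ η)) (GForm.congr_apply hf.1 k ℓ)
      rwa [degL_apply, GForm.smul_apply, map_smul, map_smul] at h1
  · cases ℓ with
    | zero =>
      exact (smul_zero (A := Form V k 0) ((0 : ℕ) : ℝ)).trans (smul_zero (A := Form V k 0) (b + 1)).symm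
    | succ ℓ =>
      have h1 := congrArg (mapSnd k (wedgeOne ℓ η)) (GForm.congr_apply hf.2 k ℓ)
      rw [degR_apply, GForm.smul_apply, map_smul, map_smul] at h1
      change ((ℓ + 1 : ℕ) : ℝ) • mapSnd k (wedgeOne ℓ η) (f k ℓ) =
        (b + 1) • mapSnd k (wedgeOne ℓ η) (f k ℓ)
      push_cast
      rw [add_smul, add_smul, h1]

variable {ι : Type*} [Fintype ι] (lam : ι → V →ₗ[ℝ] ℝ) (e : ι → V)

/-- The operator `∑ᵢ (s ⊗ λᵢ + λᵢ ⊗ s) ∧ (eᵢ ⊗ eᵢ) ⌟ ·` with `s = ∑ᵢ λᵢ`. -/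
def diagOp : Module.End ℝ (GForm V) :=
  ∑ i, (wedL (∑ i, lam i) * wedR (lam i) + wedR (∑ i, lam i) * wedL (lam i)) *
    (insL (e i) * insR (e i))

theorem diagOp_apply (f : GForm V) :
    diagOp lam e f = ∑ i, (wedL (∑ i, lam i) (wedR (lam i) (insL (e i) (insR (e i) f))) +
      wedR (∑ i, lam i) (wedL (lam i) (insL (e i) (insR (e i) f)))) := by
  rw [diagOp, LinearMap.sum_apply]
  rfl

theorem IsDeg.diagOp {a b : ℝ} {f : GForm V} (hf : IsDeg a b f) : IsDeg a b (diagOp lam e f) := by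
  rw [diagOp_apply]
  refine Finset.sum_induction _ (IsDeg a b) (fun _ _ h h' => h.add h') (IsDeg.zero a b) ?_
  intro i _
  have h := (hf.insR (e i)).insL (e i)
  refine IsDeg.add ?_ ?_
  · convert (h.wedR (lam i)).wedL _ using 1 <;> ring
  · convert (h.wedL (lam i)).wedR _ using 1 <;> ring

/-- The symmetrization is what makes this work: passing `gSd` through the two exterior products
produces the second-factor product of s and λᵢ with opposite signs. Passing it through the double
contraction produces eᵢ contracted twice in the first factor, which is zero. -/
theorem gSd_mul_diagOp [FiniteDimensional ℝ V] : gSd * diagOp lam e = diagOp lam e * gSd := by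
  rw [diagOp, Finset.mul_sum, Finset.sum_mul]
  refine Finset.sum_congr rfl fun i _ => ?_
  set s := ∑ i, lam i
  have h1 : gSd * (wedL s * wedR (lam i) + wedR s * wedL (lam i)) =
      (wedL s * wedR (lam i) + wedR s * wedL (lam i)) * gSd := by
    rw [mul_add, ← mul_assoc, ← mul_assoc, gSd_mul_wedL, gSd_mul_wedR, sub_mul, neg_mul,
      mul_assoc (wedR s), gSd_mul_wedL, mul_assoc (wedL s), gSd_mul_wedR]
    noncomm_ring
  have h2 : gSd * (insL (e i) * insR (e i)) = insL (e i) * insR (e i) * gSd := by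
    have h3 := insR_mul_gSd (e i)
    rw [← mul_assoc, gSd_mul_insL, mul_assoc, h3, mul_sub, insL_mul_self, zero_sub, neg_mul,
      mul_assoc]
  rw [← mul_assoc, h1, mul_assoc, h2, mul_assoc, mul_assoc, mul_assoc]

/-- Every term contains a factor s. -/
theorem gPull_ker_diagOp (f : GForm V) :
    gPull (LinearMap.ker (∑ i, lam i)).subtype (diagOp lam e f) = 0 := by
  have h : (∑ i, lam i) ∘ₗ (LinearMap.ker (∑ i, lam i)).subtype = 0 := by
    ext x
    exact x.2
  rw [diagOp_apply, map_sum]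
  refine Finset.sum_eq_zero fun i _ => ?_
  rw [map_add, gPull_wedL, gPull_wedR _ (∑ i, lam i), h]
  simp

/-- Naturality of `diagOp` under inclusions of coordinate subspaces. -/
theorem gPull_diagOp {U : Type*} [AddCommGroup U] [Module ℝ U] {κ : Type*} [Fintype κ]
    {lam' : κ → U →ₗ[ℝ] ℝ} {e' : κ → U} (j : U →ₗ[ℝ] V) (φ : κ ↪ ι)
    (he : ∀ a, j (e' a) = e (φ a)) (hl : ∀ a, lam (φ a) ∘ₗ j = lam' a)
    (hl0 : ∀ i, i ∉ Set.range φ → lam i ∘ₗ j = 0) (f : GForm V) :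
    gPull j (diagOp lam e f) = diagOp lam' e' (gPull j f) := by
  classical
  have hsum : ∀ {A : Type _} [AddCommMonoid A] (F : ι → A), (∀ i, i ∉ Set.range φ → F i = 0) →
      ∑ i, F i = ∑ a, F (φ a) := by
    intro A _ F hF
    rw [← Finset.sum_map Finset.univ φ F]
    refine (Finset.sum_subset (Finset.subset_univ _) fun i _ hi => hF i ?_).symm
    rintro ⟨a, rfl⟩
    exact hi (by simp)
  have hs : (∑ i, lam i) ∘ₗ j = ∑ a, lam' a := by
    have h1 : (∑ i, lam i) ∘ₗ j = ∑ i, lam i ∘ₗ j := by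
      ext x
      simp
    rw [h1, hsum _ hl0]
    exact Finset.sum_congr rfl fun a _ => hl a
  rw [diagOp_apply, diagOp_apply, map_sum, hsum]
  · refine Finset.sum_congr rfl fun a _ => ?_
    rw [map_add, gPull_wedL, gPull_wedR, gPull_wedR, gPull_wedL, hs, hl, ← he, gPull_insL,
      gPull_insR]
  · intro i hi
    rw [map_add, gPull_wedL, gPull_wedR, gPull_wedR, gPull_wedL, hl0 i hi]
    simp

end Polarization

/-! ### Injectivity of `diagOp` on forms vanishing on ker s. -/

section DiagOpInjective

variable {V : Type*} [AddCommGroup V] [Module ℝ V] [FiniteDimensional ℝ V]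

theorem gSd_pow_insL (w : V) (f : GForm V) (q : ℕ) :
    (gSd ^ q) (insL w f) = (-1 : ℝ) ^ q • insL w ((gSd ^ q) f) := by
  induction q with
  | zero => simp
  | succ q ih =>
    have h : gSd (insL w ((gSd ^ q) f)) = -insL w (gSd ((gSd ^ q) f)) :=
      LinearMap.congr_fun (gSd_mul_insL w) _
    rw [pow_succ_apply', ih, map_smul, h, pow_succ_apply', pow_succ]
    simp

theorem insR_gSd_pow (w : V) (f : GForm V) (q : ℕ) :
    insR w ((gSd ^ (q + 1)) f) =
      (-1 : ℝ) ^ q • (((q : ℝ) + 1) • (gSd ^ q) (insL w f) - (gSd ^ (q + 1)) (insR w f)) := by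
  have h : ∀ g : GForm V, insR w (gSd g) = insL w g - gSd (insR w g) :=
    fun g => LinearMap.congr_fun (insR_mul_gSd w) g
  induction q with
  | zero => simp [h]
  | succ q ih =>
    have h1 : insL w ((gSd ^ (q + 1)) f) = (-1 : ℝ) ^ (q + 1) • (gSd ^ (q + 1)) (insL w f) := by
      rw [gSd_pow_insL, smul_smul, ← mul_pow]
      simp
    rw [pow_succ_apply' gSd (q + 1), h, ih, h1, map_smul, map_sub, map_smul, ← pow_succ_apply',
      ← pow_succ_apply', pow_succ]
    push_cast
    module

variable {ι : Type*} [Fintype ι] {lam : ι → V →ₗ[ℝ] ℝ} {e : ι → V}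

/-- The first relation makes X a negative multiple of 𝒮_†Y. The third then gives a negative multiple
of 𝒮_†^(q+1)Y, hence 𝒮_†^(q+1)Y = 0. The first two make Y an eigenvector of 𝒮𝒮_† with eigenvalue kℓ,
so 𝒮 undoes 𝒮_† along the chain of Y with scalars (k - j)(ℓ + j), nonzero for j ≤ q. -/
theorem eq_zero_of_gSd_pow_of_proportional {X Y : GForm V} {k ℓ q : ℕ} (hq : q + 1 ≤ k)
    (hℓ : 1 ≤ ℓ) (hY : IsDeg k (ℓ - 1) Y) (h1 : (ℓ : ℝ) • X + gSd Y = 0)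
    (h2 : (k : ℝ) • Y + gS X = 0)
    (h3 : ((q : ℝ) + 1) • (gSd ^ q) X - (gSd ^ (q + 1)) Y = 0) : X = 0 ∧ Y = 0 := by
  have hℓ0 : (0 : ℝ) < ℓ := by exact_mod_cast hℓ
  have hXY : X = (-(ℓ : ℝ)⁻¹) • gSd Y := by
    rw [eq_neg_of_add_eq_zero_right h1, smul_neg, neg_smul, neg_neg, smul_smul,
      inv_mul_cancel₀ hℓ0.ne', one_smul]
  have hq0 : (gSd ^ (q + 1)) Y = 0 := by
    have h4 : (gSd ^ q) X = (-(ℓ : ℝ)⁻¹) • (gSd ^ (q + 1)) Y := by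
      rw [hXY, map_smul, pow_succ, Module.End.mul_apply]
    replace h3 : (((q : ℝ) + 1) * -(ℓ : ℝ)⁻¹ - 1) • (gSd ^ (q + 1)) Y = 0 := by
      rw [sub_smul, one_smul, ← smul_smul, ← h4, h3]
    refine (smul_eq_zero.1 h3).resolve_left ?_
    have : 0 ≤ ((q : ℝ) + 1) * (ℓ : ℝ)⁻¹ := by positivity
    linarith
  have hYY : gS (gSd Y) = ((k : ℝ) * ℓ) • Y := by
    have h4 : gSd Y = -((ℓ : ℝ) • X) := eq_neg_of_add_eq_zero_right h1
    have h5 : gS X = -((k : ℝ) • Y) := eq_neg_of_add_eq_zero_right h2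
    rw [h4, map_neg, map_smul, h5, smul_neg, neg_neg, smul_smul, mul_comm]
  have hY0 : Y = 0 := by
    refine eq_zero_of_lower_pow_of_raise_lower (E := gS) (F := gSd) (q := q + 1)
      (c := fun j => ((k : ℝ) - j) * (ℓ + j)) (fun j hj => ?_) (fun j _ => ?_) hq0
    · have : (j : ℝ) + 1 ≤ k := by exact_mod_cast (by omega : j + 1 ≤ k)
      exact mul_ne_zero (by linarith) (by positivity)
    · cases j with
      | zero => simp [hYY]
      | succ j =>
        have hw := hY.gSd.weight
        rw [pow_succ, Module.End.mul_apply, raise_lower_pow gS_gSd weight_gSd hw, hYY, map_smul,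
          ← Module.End.mul_apply, ← pow_succ, ← add_smul]
        congr 1
        push_cast
        ring
  exact ⟨by rw [hXY, hY0, map_zero, smul_zero], hY0⟩

/-- Since f vanishes on ker s, it is determined by the restrictions X, Y, Z to ker s of its
contractions with e_{i₀} in the first, the second and both factors. Contracting `diagOp lam e f` the
same way yields linear relations that force these to vanish. -/
theorem eq_zero_of_diagOp_eq_zero (hle : ∀ x, ∑ i, lam i x • e i = x)
    (hs : ∀ i, (∑ j, lam j) (e i) = 1) (i₀ : ι) {k ℓ p : ℕ} (hp : p ≤ k) (hℓ : 1 ≤ ℓ)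
    {f : GForm V} (hf : IsDeg k ℓ f) (hfp : (gSd ^ p) f = 0)
    (hf0 : gPull (LinearMap.ker (∑ i, lam i)).subtype f = 0) (hR : diagOp lam e f = 0) : f = 0 := by
  obtain _ | q := p
  · exact hfp
  set s := ∑ i, lam i with hsdef
  set r := gPull (LinearMap.ker s).subtype with hr
  set X := r (insL (e i₀) f) with hX
  set Y := r (insR (e i₀) f) with hY
  set Z := r (insL (e i₀) (insR (e i₀) f)) with hZ
  have hsum : ∀ x : V, ∑ i, lam i x = s x := fun x => by rw [hsdef, LinearMap.sum_apply]
  -- The eᵢ - e_{i₀} and the restricted λᵢ resolve the identity of ker s. They are overcomplete: the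
  -- restricted functionals sum to zero.
  let t : ι → LinearMap.ker s := fun i => ⟨e i - e i₀, by simp [hs]⟩
  let mu : ι → LinearMap.ker s →ₗ[ℝ] ℝ := fun i => lam i ∘ₗ (LinearMap.ker s).subtype
  have hmut : ∀ x, ∑ i, mu i x • t i = x := by
    intro x
    apply Subtype.ext
    have : ∑ i, lam i (x : V) • (e i - e i₀) = x := by
      simp only [smul_sub, Finset.sum_sub_distrib]
      rw [hle, ← Finset.sum_smul, hsum, x.2, zero_smul, sub_zero]
    simpa [mu, t] using this
  have hmu0 : ∑ i, mu i = 0 := by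
    ext x
    simp [mu, hsum]
  have hei : ∀ i, e i = e i₀ + (LinearMap.ker s).subtype (t i) := fun i => by simp [t]
  have hLi : ∀ i g, insL (e i) g = insL (e i₀) g + insL ((LinearMap.ker s).subtype (t i)) g :=
    fun i g => by
      conv_lhs => rw [hei i]
      rw [map_add, LinearMap.add_apply]
  have hRi : ∀ i g, insR (e i) g = insR (e i₀) g + insR ((LinearMap.ker s).subtype (t i)) g :=
    fun i g => by
      conv_lhs => rw [hei i]
      rw [map_add, LinearMap.add_apply]
  have hLR : ∀ (x y : V) g, insL x (insR y g) = insR y (insL x g) := fun _ _ _ => rfl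
  have hrs : ∀ g, r (wedL s g) = 0 := fun g => by
    have : s ∘ₗ (LinearMap.ker s).subtype = 0 := by ext x; exact x.2
    rw [hr, gPull_wedL, this, map_zero, LinearMap.zero_apply]
  have hrs' : ∀ g, r (wedR s g) = 0 := fun g => by
    have : s ∘ₗ (LinearMap.ker s).subtype = 0 := by ext x; exact x.2
    rw [hr, gPull_wedR, this, map_zero, LinearMap.zero_apply]
  have cLL : ∀ (x : V) η g, insL x (wedL η g) = η x • g - wedL η (insL x g) :=
    fun x η g => LinearMap.congr_fun (insL_mul_wedL x η) g
  have cRR : ∀ (x : V) η g, insR x (wedR η g) = η x • g - wedR η (insR x g) :=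
    fun x η g => LinearMap.congr_fun (insR_mul_wedR x η) g
  have cLR : ∀ (x : V) η g, insL x (wedR η g) = wedR η (insL x g) :=
    fun x η g => LinearMap.congr_fun (insL_mul_wedR x η) g
  have cRL : ∀ (x : V) η g, insR x (wedL η g) = wedL η (insR x g) :=
    fun x η g => LinearMap.congr_fun (insR_mul_wedL x η) g
  have rL : ∀ x g, r (insL ((LinearMap.ker s).subtype x) g) = insL x (r g) :=
    fun x g => gPull_insL _ x g
  have rR : ∀ x g, r (insR ((LinearMap.ker s).subtype x) g) = insR x (r g) :=
    fun x g => gPull_insR _ x g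
  have rwL : ∀ i g, r (wedL (lam i) g) = wedL (mu i) (r g) := fun i g => gPull_wedL _ _ g
  have rwR : ∀ i g, r (wedR (lam i) g) = wedR (mu i) (r g) := fun i g => gPull_wedR _ _ g
  have hD : diagOp lam e f = ∑ i, (wedL s (wedR (lam i) (insL (e i) (insR (e i) f))) +
      wedR s (wedL (lam i) (insL (e i) (insR (e i) f)))) := diagOp_apply lam e f
  -- Writing eᵢ = e_{i₀} + tᵢ in both factors, the term with tᵢ twice drops out because f vanishes
  -- on ker s.
  have hrh : ∀ i, r (insL (e i) (insR (e i) f)) = Z + insR (t i) X + insL (t i) Y := by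
    intro i
    have h1 : r (insL (e i₀) (insR ((LinearMap.ker s).subtype (t i)) f)) = insR (t i) X := by
      rw [hLR, rR]
    rw [hLi, hRi, map_add, map_add, map_add, map_add, map_add, h1, rL, rL, rR, hf0,
      map_zero, map_zero, add_zero]
  -- Contraction with e_{i₀} removes the factor s, as s(e_{i₀}) = 1. The Z terms cancel because the
  -- restricted λᵢ sum to zero, and the others are expansions of `degR` and `gSd`.
  have hdX : degR X + gSd Y = 0 := by
    have h1 : r (insL (e i₀) (diagOp lam e f)) = 0 := by rw [hR, map_zero, map_zero]
    rw [hD, map_sum, map_sum] at h1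
    rw [← sum_wedR_insR hmut, ← sum_wedR_insL hmut, ← Finset.sum_add_distrib, ← h1]
    have h2 : (∑ i, wedR (mu i) Z) = 0 := by
      rw [← LinearMap.sum_apply, ← map_sum, hmu0, map_zero, LinearMap.zero_apply]
    rw [← zero_add (∑ i, _), ← h2, ← Finset.sum_add_distrib]
    refine Finset.sum_congr rfl fun i _ => ?_
    have h3 : ∀ g, r (insL (e i₀) (wedL s g)) = r g := fun g => by
      rw [cLL, hs, one_smul, map_sub, hrs, sub_zero]
    have h4 : ∀ g, r (insL (e i₀) (wedR s g)) = 0 := fun g => by rw [cLR, hrs']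
    rw [map_add, map_add, h3, h4, add_zero, rwR, hrh, map_add, map_add, add_assoc]
  have hdY : degL Y + gS X = 0 := by
    have h1 : r (insR (e i₀) (diagOp lam e f)) = 0 := by rw [hR, map_zero, map_zero]
    rw [hD, map_sum, map_sum] at h1
    rw [← sum_wedL_insL hmut, ← sum_wedL_insR hmut, ← Finset.sum_add_distrib, ← h1]
    have h2 : (∑ i, wedL (mu i) Z) = 0 := by
      rw [← LinearMap.sum_apply, ← map_sum, hmu0, map_zero, LinearMap.zero_apply]
    rw [← zero_add (∑ i, _), ← h2, ← Finset.sum_add_distrib]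
    refine Finset.sum_congr rfl fun i _ => ?_
    have h3 : ∀ g, r (insR (e i₀) (wedR s g)) = r g := fun g => by
      rw [cRR, hs, one_smul, map_sub, hrs', sub_zero]
    have h4 : ∀ g, r (insR (e i₀) (wedL s g)) = 0 := fun g => by rw [cRL, hrs]
    rw [map_add, map_add, h3, h4, zero_add, rwL, hrh, map_add, map_add]
    abel
  have hXdeg : IsDeg (k - 1) ℓ X := (hf.insL _).gPull _
  have hYdeg : IsDeg k (ℓ - 1) Y := (hf.insR _).gPull _
  have hXY : X = 0 ∧ Y = 0 := by
    rw [hXdeg.2] at hdX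
    rw [hYdeg.1] at hdY
    refine eq_zero_of_gSd_pow_of_proportional hp hℓ hYdeg hdX hdY ?_
    -- The third relation between X and Y comes from contracting 𝒮_†^(q+1) f = 0 in the second
    -- factor.
    have h1 : r (insR (e i₀) ((gSd ^ (q + 1)) f)) = 0 := by rw [hfp, map_zero, map_zero]
    rw [insR_gSd_pow, map_smul, map_sub, map_smul, hr, gPull_gSd_pow, gPull_gSd_pow] at h1
    exact (smul_eq_zero.1 h1).resolve_left (by simp)
  -- Contracting in both factors gives (2 + `degL` + `degR`) Z = 0, where 2 is 2 ∑ λᵢ(e_{i₀}). This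
  -- operator is positive in every degree.
  have hZ0 : Z = 0 := by
    have hLL : ∀ (x y : V) g, insL x (insL y g) = -insL y (insL x g) :=
      fun x y g => LinearMap.congr_fun (insL_anticomm x y) g
    have hRR : ∀ (x y : V) g, insR x (insR y g) = -insR y (insR x g) :=
      fun x y g => LinearMap.congr_fun (insR_anticomm x y) g
    have hLL0 : ∀ (x : V) g, insL x (insL x g) = 0 :=
      fun x g => LinearMap.congr_fun (insL_mul_self x) g
    have hRR0 : ∀ (x : V) g, insR x (insR x g) = 0 :=
      fun x g => LinearMap.congr_fun (insR_mul_self x) g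
    have hrh' : ∀ i, r (insL (e i) (insR (e i) f)) = Z := fun i => by
      rw [hrh, hXY.1, hXY.2]
      simp
    have hA : ∀ i, r (insR (e i₀) (insL (e i) (insR (e i) f))) = -insR (t i) Z := fun i => by
      have h1 : insR (e i₀) (insL (e i) (insR (e i) f)) =
          -insR ((LinearMap.ker s).subtype (t i)) (insL (e i) (insR (e i₀) f)) := by
        rw [← hLR, hRR, hRi i (insR (e i₀) f), hRR0, zero_add, map_neg, hLR]
      rw [h1, map_neg, rR, hLi, map_add, rL, hY.symm, hXY.2, map_zero, add_zero]
    have hB : ∀ i, r (insL (e i₀) (insL (e i) (insR (e i) f))) = -insL (t i) Z := fun i => by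
      have h1 : insL (e i₀) (insL (e i) (insR (e i) f)) =
          -insL ((LinearMap.ker s).subtype (t i)) (insR (e i) (insL (e i₀) f)) := by
        rw [hLR (e i), hLR (e i₀), hLL, hLi i (insL (e i₀) f), hLL0, zero_add, map_neg, hLR]
      have h2 : r (insR (e i₀) (insL (e i₀) f)) = Z := rfl
      rw [h1, map_neg, rL, hRi, map_add, rR, hX.symm, hXY.1, map_zero, add_zero, h2]
    have h1 : r (insR (e i₀) (insL (e i₀) (diagOp lam e f))) = 0 := by
      rw [hR, map_zero, map_zero, map_zero]
    rw [hD, map_sum, map_sum, map_sum] at h1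
    have h2 : ∀ i ∈ Finset.univ, r (insR (e i₀) (insL (e i₀)
        (wedL s (wedR (lam i) (insL (e i) (insR (e i) f))) +
          wedR s (wedL (lam i) (insL (e i) (insR (e i) f)))))) =
        (2 * lam i (e i₀)) • Z + wedR (mu i) (insR (t i) Z) + wedL (mu i) (insL (t i) Z) := by
      intro i _
      have h3 : ∀ g, r (insR (e i₀) (insL (e i₀) (wedL s g))) = r (insR (e i₀) g) := fun g => by
        rw [cLL, hs, one_smul, map_sub, cRL, map_sub, hrs, sub_zero]
      have h4 : ∀ g, r (insR (e i₀) (insL (e i₀) (wedR s g))) = r (insL (e i₀) g) := fun g => by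
        rw [← hLR, cRR, hs, one_smul, map_sub, cLR, map_sub, hrs', sub_zero]
      rw [map_add, map_add, map_add, h3, h4, cRR, cLL, map_sub, map_sub, map_smul, hrh', rwR, rwL,
        hA, hB, map_neg, map_neg, two_mul, add_smul]
      abel
    rw [Finset.sum_congr rfl h2] at h1
    rw [Finset.sum_add_distrib, Finset.sum_add_distrib,
      sum_wedR_insR hmut, sum_wedL_insL hmut, ← Finset.sum_smul, ← Finset.mul_sum, hsum, hs] at h1
    refine GForm.ext fun a b => ?_
    have h3 := GForm.congr_apply h1 a b
    rw [GForm.add_apply, GForm.add_apply, degL_apply, degR_apply, GForm.smul_apply, ← add_smul,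
      ← add_smul] at h3
    exact (Form.smul_eq_zero.1 h3).resolve_left (by positivity)
  exact gForm_eq_zero_of_ker (hs i₀) hf0 hXY.1 hXY.2 hZ0

end DiagOpInjective

/-! ### Finite dimension, and lifts annihilated by `diagOp`. -/

theorem finiteDimensional_alternatingMap {V N ι : Type*} [AddCommGroup V] [Module ℝ V]
    [FiniteDimensional ℝ V] [AddCommGroup N] [Module ℝ N] [FiniteDimensional ℝ N] [Finite ι] :
    FiniteDimensional ℝ (V [⋀^ι]→ₗ[ℝ] N) := by
  let b := Module.finBasis ℝ V
  let ev : (V [⋀^ι]→ₗ[ℝ] N) →ₗ[ℝ] ((ι → Fin (Module.finrank ℝ V)) → N) :=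
    { toFun := fun f I => f fun i => b (I i)
      map_add' := fun _ _ => rfl
      map_smul' := fun _ _ => rfl }
  exact Module.Finite.of_injective ev fun f g h =>
    Module.Basis.ext_alternating b fun I _ => congrFun h I

theorem finiteDimensional_form {V : Type*} [AddCommGroup V] [Module ℝ V]
    [FiniteDimensional ℝ V] (k ℓ : ℕ) : FiniteDimensional ℝ (Form V k ℓ) :=
  have : FiniteDimensional ℝ (V [⋀^Fin ℓ]→ₗ[ℝ] ℝ) := finiteDimensional_alternatingMap
  finiteDimensional_alternatingMap

/-- R restricts to an injective, hence surjective, endomorphism of N, and R x₀ lies in N. -/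
theorem exists_sub_mem_and_map_eq_zero {E : Type*} [AddCommGroup E] [Module ℝ E]
    [FiniteDimensional ℝ E] (R : E →ₗ[ℝ] E) {M N : Submodule ℝ E} (hRN : ∀ x ∈ M, R x ∈ N)
    (hNM : N ≤ M) (hN : ∀ x ∈ N, R x = 0 → x = 0) {x₀ : E} (hx₀ : x₀ ∈ M) :
    ∃ y ∈ N, R (x₀ - y) = 0 := by
  let RN : N →ₗ[ℝ] N := R.restrict fun x hx => hRN x (hNM hx)
  have hinj : Function.Injective RN := by
    refine (injective_iff_map_eq_zero RN).2 ?_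
    rintro ⟨x, hx⟩ h
    exact Subtype.ext (hN x hx (congrArg Subtype.val h))
  obtain ⟨y, hy⟩ := LinearMap.surjective_of_injective hinj ⟨R x₀, hRN x₀ hx₀⟩
  refine ⟨y, y.2, ?_⟩
  rw [map_sub, sub_eq_zero]
  exact (congrArg Subtype.val hy).symm

section Lift

variable {V : Type*} [AddCommGroup V] [Module ℝ V] [FiniteDimensional ℝ V]
  {ι : Type*} [Fintype ι] {lam : ι → V →ₗ[ℝ] ℝ} {e : ι → V}

theorem gSd_pow_diagOp (p : ℕ) (f : GForm V) :
    (gSd ^ p) (diagOp lam e f) = diagOp lam e ((gSd ^ p) f) := by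
  induction p with
  | zero => rfl
  | succ p ih =>
    rw [pow_succ_apply', ih, pow_succ_apply']
    exact LinearMap.congr_fun (gSd_mul_diagOp lam e) _

/-- An arbitrary lift is corrected by an element of 𝕎_{[p]} vanishing on ker s, which leaves the
restriction unchanged. -/
theorem exists_lift_diagOp_eq_zero (hle : ∀ x, ∑ i, lam i x • e i = x)
    (hs : ∀ i, (∑ j, lam j) (e i) = 1) (i₀ : ι) {k ℓ p : ℕ} (hp : p ≤ k) (hℓ : 1 ≤ ℓ)
    {ω₀ : Form V k ℓ} (hω₀ : ω₀ ∈ W V k ℓ p) :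
    ∃ ω ∈ W V k ℓ p, pullback (LinearMap.ker (∑ i, lam i)).subtype k ℓ ω =
      pullback (LinearMap.ker (∑ i, lam i)).subtype k ℓ ω₀ ∧
      diagOp lam e (gSingle k ℓ ω) = 0 := by
  let R : Form V k ℓ →ₗ[ℝ] Form V k ℓ := gComp k ℓ ∘ₗ diagOp lam e ∘ₗ gSingle k ℓ
  have hR : ∀ ω, diagOp lam e (gSingle k ℓ ω) = gSingle k ℓ (R ω) :=
    fun ω => ((isDeg_gSingle k ℓ ω).diagOp lam e).eq_gSingle
  let N : Submodule ℝ (Form V k ℓ) :=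
    W V k ℓ p ⊓ LinearMap.ker (pullback (LinearMap.ker (∑ i, lam i)).subtype k ℓ)
  have hRN : ∀ ω ∈ W V k ℓ p, R ω ∈ N := by
    intro ω hω
    rw [mem_W_iff hp] at hω
    refine ⟨?_, ?_⟩
    · rw [SetLike.mem_coe, mem_W_iff hp, ← hR, gSd_pow_diagOp, hω, map_zero]
    · exact GForm.congr_apply (gPull_ker_diagOp lam e (gSingle k ℓ ω)) k ℓ
  have : FiniteDimensional ℝ (Form V k ℓ) := finiteDimensional_form k ℓ
  obtain ⟨ν, hν, hν'⟩ := exists_sub_mem_and_map_eq_zero (E := Form V k ℓ) R (M := W V k ℓ p)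
    (N := N) hRN inf_le_left (fun ω hω h => by
      have h2 : gSingle k ℓ ω = 0 := by
        refine eq_zero_of_diagOp_eq_zero hle hs i₀ hp hℓ (isDeg_gSingle k ℓ ω)
          ((mem_W_iff hp).1 hω.1) ?_ (by rw [hR, h, map_zero])
        rw [gPull_gSingle, LinearMap.mem_ker.1 hω.2, map_zero]
      have h3 := GForm.congr_apply h2 k ℓ
      rwa [gSingle_same] at h3) hω₀
  refine ⟨ω₀ - ν, Submodule.sub_mem (M := Form V k ℓ) _ hω₀ hν.1, ?_, ?_⟩
  · have h0 : pullback (LinearMap.ker (∑ i, lam i)).subtype k ℓ ν = 0 := hν.2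
    refine (LinearMap.map_sub (M := Form V k ℓ)
      (M₂ := Form (LinearMap.ker (∑ i, lam i)) k ℓ) _ _ _).trans ?_
    rw [h0]
    exact sub_zero (G := Form (LinearMap.ker (∑ i, lam i)) k ℓ) _
  · rw [hR, hν', map_zero]

end Lift

/-! ### Bubbles in the test space are constant. -/

section Bubble

variable {V : Type*} [AddCommGroup V] [Module ℝ V]

theorem gSingle_curryLeft {k ℓ : ℕ} (c : Form V (k + 1) ℓ) (t : V) :
    gSingle k ℓ (c.curryLeft t) = insL t (gSingle (k + 1) ℓ c) := by
  refine (isDeg_gSingle k ℓ _).ext ?_ ?_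
  · have h := (isDeg_gSingle (k + 1) ℓ c).insL t
    push_cast at h
    rwa [_root_.add_sub_cancel_right] at h
  · rw [gSingle_same]
    change _ = (gSingle (k + 1) ℓ c (k + 1) ℓ).curryLeft t
    rw [gSingle_same]

/-- Contraction anticommutes with 𝒮_†, so all contractions of 𝒮_†^(m+1) c vanish. That form has
degree a ≥ 1 in the first factor, so it is zero, and 𝒮_†^(m+1) is injective in the weight b + 1 - a
= m + 1 of c. -/
theorem eq_zero_of_forall_curryLeft_mem_W [FiniteDimensional ℝ V] {a b m : ℕ}
    (hm : b - a = m) (ha : 1 ≤ a) (hab : a ≤ b) {c : Form V (b + 1) a} (h : ∀ t, c.curryLeft t ∈ W V b a (m + 1)) : c = 0 := by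
  have hmb : m + 1 ≤ b := by omega
  have hc := isDeg_gSingle (b + 1) a c
  have h1 : (gSd ^ (m + 1)) (gSingle (b + 1) a c) = 0 := by
    have hdeg : IsDeg (a : ℕ) ((b + 1 : ℕ) : ℝ) ((gSd ^ (m + 1)) (gSingle (b + 1) a c)) := by
      convert hc.gSd_pow (m + 1) using 1
      · rw [← Nat.cast_sub (by omega)]
        congr 1
        omega
      · rw [← Nat.cast_add]
        congr 1
        omega
    refine hdeg.eq_zero ?_
    obtain ⟨a', rfl⟩ : ∃ a', a = a' + 1 := ⟨a - 1, by omega⟩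
    ext v u
    have h2 : insL (v 0) ((gSd ^ (m + 1)) (gSingle (b + 1) (a' + 1) c)) = 0 := by
      have h3 := (mem_W_iff hmb).1 (h (v 0))
      rw [gSingle_curryLeft, gSd_pow_insL] at h3
      exact (smul_eq_zero.1 h3).resolve_left (by simp)
    have h4 := congrArg (fun α : Form V a' (b + 1) => α (Fin.tail v) u)
      (GForm.congr_apply h2 a' (b + 1))
    change ((gSd ^ (m + 1)) (gSingle (b + 1) (a' + 1) c)) (a' + 1) (b + 1)
      (Matrix.vecCons (v 0) (Fin.tail v)) u = 0 at h4
    rwa [Matrix.vecCons, Fin.cons_self_tail] at h4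
  have hw := hc.weight
  have h2 : gSingle (b + 1) a c = 0 := by
    refine eq_zero_of_lower_pow gS_gSd weight_gS weight_gSd (a + 1) (m := m + 1) (q := m + 1)
      (gS_pow_eq_zero hc) ?_ h1 le_rfl
    rw [hw]
    congr 1
    rw [← Nat.cast_sub (by omega)]
    congr 1
    omega
  rw [← gSingle_same (b + 1) a c, h2]
  rfl

variable {n : ℕ}

theorem mem_bubbleW {σ : Finset (EuclideanSpace ℝ (Fin n))} {k ℓ p : ℕ} {b : Field σ k ℓ} :
    b ∈ bubbleW σ k ℓ p ↔ b ∈ bubble σ k ℓ ∧ ∀ x, b x ∈ W (tangent σ) k ℓ p :=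
  and_congr Iff.rfl ⟨fun h x => congrFun h x, fun h => funext h⟩

/-- Constant forms in `𝕎_{[p]}^{k,ℓ}(σ)` whose double trace vanishes on all proper subsimplices. -/
def traceFreeW (σ : Finset (EuclideanSpace ℝ (Fin n))) (k ℓ p : ℕ) :
    Submodule ℝ (Form (tangent σ) k ℓ) :=
  W (tangent σ) k ℓ p ⊓ ⨅ (F : Finset (EuclideanSpace ℝ (Fin n))) (h : F ⊂ σ) (_ : F.Nonempty),
    LinearMap.ker (faceTrace h.subset k ℓ)

theorem mem_traceFreeW {σ : Finset (EuclideanSpace ℝ (Fin n))} {k ℓ p : ℕ}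
    {β : Form (tangent σ) k ℓ} : β ∈ traceFreeW σ k ℓ p ↔ β ∈ W (tangent σ) k ℓ p ∧
      ∀ (F : Finset (EuclideanSpace ℝ (Fin n))) (h : F ⊂ σ), F.Nonempty →
        faceTrace h.subset k ℓ β = 0 := by
  simp only [traceFreeW, Submodule.mem_inf, Submodule.mem_iInf, LinearMap.mem_ker]

theorem constField_mem_bubbleW {σ : Finset (EuclideanSpace ℝ (Fin n))} {k ℓ p : ℕ}
    {β : Form (tangent σ) k ℓ} (h : β ∈ traceFreeW σ k ℓ p) :
    constField σ k ℓ β ∈ bubbleW σ k ℓ p := by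
  rw [mem_traceFreeW] at h
  exact mem_bubbleW.2 ⟨⟨Submodule.mem_sup_left ⟨β, rfl⟩, fun F hF hne _ _ => h.2 F hF hne⟩,
    fun _ => h.1⟩

/-- The value at the origin puts the constant part in 𝕎, hence all contractions of the Koszul
coefficient too, and that coefficient vanishes. -/
theorem exists_constField_of_mem_bubbleW {σ : Finset (EuclideanSpace ℝ (Fin n))} {a b m : ℕ}
    (hm : b - a = m) (ha : 1 ≤ a) (hab : a ≤ b) {f : Field σ b a} (hf : f ∈ bubbleW σ b a (m + 1)) :
    ∃ β ∈ traceFreeW σ b a (m + 1), f = constField σ b a β := by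
  rw [mem_bubbleW] at hf
  obtain ⟨⟨hw, htr⟩, hW⟩ := hf
  obtain ⟨_, ⟨A, rfl⟩, _, ⟨c, rfl⟩, hfA⟩ := Submodule.mem_sup.1 hw
  have hfx : ∀ x, f x = A + c.curryLeft ((tangent σ).orthogonalProjectionOnto x) :=
    fun x => (congrFun hfA x).symm
  have hA : A ∈ W (tangent σ) b a (m + 1) := by
    have h := hW 0
    rw [hfx, map_zero, map_zero, add_zero] at h
    exact h
  have hc : c = 0 := by
    refine eq_zero_of_forall_curryLeft_mem_W hm ha hab fun t => ?_
    have h := hW t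
    rw [hfx, Submodule.orthogonalProjectionOnto_mem_subspace_eq_self] at h
    exact (Submodule.add_mem_iff_right (M := Form (tangent σ) b a)
      (W (tangent σ) b a (m + 1)) hA).1 h
  have hfc : f = constField σ b a A := by
    rw [← hfA, hc, map_zero, add_zero]
  refine ⟨A, mem_traceFreeW.2 ⟨hA, fun F hF hne => ?_⟩, hfc⟩
  obtain ⟨x, hx⟩ := hne
  have h := htr F hF ⟨x, hx⟩ x (subset_convexHull ℝ _ hx)
  rwa [hfc] at h

end Bubble

/-! ### The mirror map and the decomposition of 𝕎_{[p]} into sl₂ strings. -/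

section Mirror

variable {V : Type*} [AddCommGroup V] [Module ℝ V]

theorem gSingle_sub {k ℓ : ℕ} (ω η : Form V k ℓ) :
    gSingle k ℓ (ω - η) = gSingle k ℓ ω - gSingle k ℓ η :=
  LinearMap.map_sub (M := Form V k ℓ) (gSingle k ℓ) ω η

theorem mirrorMap_eq {k ℓ s : ℕ} (hsk : s ≤ k) (hkℓ : k ≤ ℓ) (A : Form V (ℓ + s) (k - s)) :
    mirrorMap V hsk hkℓ A =
      (gS ^ s) ((gSd ^ (ℓ - k + 2 * s)) (gSingle (ℓ + s) (k - s) A)) k ℓ := by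
  rw [← mirrorMap_apply, gSingle_same]

theorem pullback_mirrorMap {U : Type*} [AddCommGroup U] [Module ℝ U] (g : U →ₗ[ℝ] V) {k ℓ s : ℕ}
    (hsk : s ≤ k) (hkℓ : k ≤ ℓ) (A : Form V (ℓ + s) (k - s)) :
    pullback g k ℓ (mirrorMap V hsk hkℓ A) = mirrorMap U hsk hkℓ (pullback g _ _ A) := by
  rw [mirrorMap_eq, mirrorMap_eq, ← gPull_gSingle, ← gPull_gSd_pow, ← gPull_gS_pow]
  rfl

theorem isDeg_gSd_pow_mirror {k ℓ s : ℕ} (hsk : s ≤ k) (hkℓ : k ≤ ℓ)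
    (A : Form V (ℓ + s) (k - s)) :
    IsDeg ((k : ℝ) - s) ((ℓ : ℝ) + s) ((gSd ^ (ℓ - k + 2 * s)) (gSingle (ℓ + s) (k - s) A)) := by
  convert (isDeg_gSingle (ℓ + s) (k - s) A).gSd_pow (ℓ - k + 2 * s) using 1 <;>
    push_cast [hsk, hkℓ] <;> ring

theorem isDeg_mirror {k ℓ s : ℕ} (hsk : s ≤ k) (hkℓ : k ≤ ℓ) (A : Form V (ℓ + s) (k - s)) :
    IsDeg k ℓ ((gS ^ s) ((gSd ^ (ℓ - k + 2 * s)) (gSingle (ℓ + s) (k - s) A))) := by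
  convert (isDeg_gSd_pow_mirror hsk hkℓ A).gS_pow s using 1 <;> ring

theorem gSingle_mirrorMap {k ℓ s : ℕ} (hsk : s ≤ k) (hkℓ : k ≤ ℓ) (A : Form V (ℓ + s) (k - s)) :
    gSingle k ℓ (mirrorMap V hsk hkℓ A) =
      (gS ^ s) ((gSd ^ (ℓ - k + 2 * s)) (gSingle (ℓ + s) (k - s) A)) := by
  rw [mirrorMap_eq]
  exact (isDeg_mirror hsk hkℓ A).eq_gSingle.symm

/-- The form to which 𝒮_{[s]} is applied in the mirror map is a lowest-weight vector. -/
theorem gSd_gSd_pow_mirror {k ℓ s : ℕ} (hsk : s < k) (hkℓ : k ≤ ℓ) {A : Form V (ℓ + s) (k - s)}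
    (hA : A ∈ W V (ℓ + s) (k - s) (ℓ - k + 2 * s + 1)) :
    gSd ((gSd ^ (ℓ - k + 2 * s)) (gSingle (ℓ + s) (k - s) A)) = 0 := by
  rw [← pow_succ_apply']
  exact (mem_W_iff (by omega)).1 hA

/-- The operator `𝒮 𝒮_†` in degree `(k, ℓ)`. -/
def casimir (V : Type*) [AddCommGroup V] [Module ℝ V] (k ℓ : ℕ) : Form V k ℓ →ₗ[ℝ] Form V k ℓ :=
  gComp k ℓ ∘ₗ gS ∘ₗ gSd ∘ₗ gSingle k ℓ

variable [FiniteDimensional ℝ V]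

/-- The image is 𝒮^s ζ with ζ of lowest weight. Applying 𝒮_†^s returns a multiple of ζ, and p > s
leaves at least one more 𝒮_†. -/
theorem mirrorMap_mem_W {k ℓ p s : ℕ} (hsp : s < p) (hpk : p ≤ k) (hkℓ : k ≤ ℓ)
    {A : Form V (ℓ + s) (k - s)} (hA : A ∈ W V (ℓ + s) (k - s) (ℓ - k + 2 * s + 1)) :
    mirrorMap V (hsp.le.trans hpk) hkℓ A ∈ W V k ℓ p := by
  rw [mem_W_iff hpk, gSingle_mirrorMap]
  have h0 := gSd_gSd_pow_mirror (hsp.trans_le hpk) hkℓ hA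
  have hdeg := isDeg_gSd_pow_mirror (hsp.le.trans hpk) hkℓ A
  set ζ := (gSd ^ (ℓ - k + 2 * s)) (gSingle (ℓ + s) (k - s) A)
  have hw : (degL - degR : Module.End ℝ (GForm V)) ζ = (-((ℓ - k + 2 * s : ℕ) : ℝ)) • ζ := by
    rw [hdeg.weight]
    congr 1
    push_cast [hkℓ]
    ring
  obtain ⟨c, -, hc⟩ := lower_pow_raise_pow gS_gSd weight_gS hw h0 s (by omega)
  obtain ⟨r, rfl⟩ : ∃ r, p = r + 1 + s := ⟨p - s - 1, by omega⟩
  rw [pow_add, Module.End.mul_apply, hc, map_smul, pow_succ, Module.End.mul_apply, h0, map_zero,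
    smul_zero]

/-- With lowest weight -(ℓ - k + 2s), the commutator formula gives s((ℓ - k + 2s) - (s - 1)). This
is strictly increasing in s and so separates the summands. -/
theorem casimir_mirrorMap {k ℓ s : ℕ} (hsk : s < k) (hkℓ : k ≤ ℓ)
    {A : Form V (ℓ + s) (k - s)} (hA : A ∈ W V (ℓ + s) (k - s) (ℓ - k + 2 * s + 1)) :
    casimir V k ℓ (mirrorMap V hsk.le hkℓ A) =
      ((s * (ℓ - k + s + 1) : ℕ) : ℝ) • mirrorMap V hsk.le hkℓ A := by
  change gS (gSd (gSingle k ℓ _)) k ℓ = _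
  rw [gSingle_mirrorMap, mirrorMap_eq, ← GForm.smul_apply]
  have h0 := gSd_gSd_pow_mirror hsk hkℓ hA
  have hdeg := isDeg_gSd_pow_mirror hsk.le hkℓ A
  set ζ := (gSd ^ (ℓ - k + 2 * s)) (gSingle (ℓ + s) (k - s) A)
  have hw : (degL - degR : Module.End ℝ (GForm V)) ζ = (-((ℓ - k + 2 * s : ℕ) : ℝ)) • ζ := by
    rw [hdeg.weight]
    congr 1
    push_cast [hkℓ]
    ring
  refine GForm.congr_apply ?_ k ℓ
  clear_value ζ
  cases s with
  | zero => simp [h0]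
  | succ s =>
    rw [lower_raise_pow gS_gSd weight_gS hw, h0, map_zero, zero_add, map_smul, ← pow_succ_apply']
    congr 1
    push_cast
    ring

/-- An element of `𝕎_{[p+1]}` differs from an image of the mirror map by an element of `𝕎_{[p]}`. -/
theorem exists_sub_mirrorMap_mem_W {k ℓ p : ℕ} (hpk : p < k) (hkℓ : k ≤ ℓ) {β : Form V k ℓ}
    (hβ : β ∈ W V k ℓ (p + 1)) : ∃ c : ℝ,
      (gS ^ (ℓ - k + 2 * p)) ((gSd ^ p) (gSingle k ℓ β)) (ℓ + p) (k - p) ∈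
        W V (ℓ + p) (k - p) (ℓ - k + 2 * p + 1) ∧
      β - c • mirrorMap V hpk.le hkℓ
        ((gS ^ (ℓ - k + 2 * p)) ((gSd ^ p) (gSingle k ℓ β)) (ℓ + p) (k - p)) ∈ W V k ℓ p := by
  have hdeg := (isDeg_gSingle k ℓ β).gSd_pow p
  have h0 : gSd ((gSd ^ p) (gSingle k ℓ β)) = 0 := by
    rw [← pow_succ_apply']
    exact (mem_W_iff hpk).1 hβ
  set ζ := (gSd ^ p) (gSingle k ℓ β) with hζ
  have hw : (degL - degR : Module.End ℝ (GForm V)) ζ = (-((ℓ - k + 2 * p : ℕ) : ℝ)) • ζ := by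
    rw [hdeg.weight]
    congr 1
    push_cast [hkℓ]
    ring
  have hη : IsDeg ((ℓ + p : ℕ) : ℝ) ((k - p : ℕ) : ℝ) ((gS ^ (ℓ - k + 2 * p)) ζ) := by
    convert hdeg.gS_pow (ℓ - k + 2 * p) using 1 <;> push_cast [hkℓ, hpk.le] <;> ring
  obtain ⟨c, hc, hcζ⟩ := lower_pow_raise_pow gS_gSd weight_gS hw h0 _ le_rfl
  obtain ⟨d, hd, hdζ⟩ := lower_pow_raise_pow gS_gSd weight_gS hw h0 p (by omega)
  -- ζ = 𝒮_†^p β is raised to the mirror degree, lowered back (factor c), raised by 𝒮^p to degree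
  -- (k, ℓ), and lowered again by 𝒮_†^p (factor d). Dividing by cd makes 𝒮_†^p of the correction
  -- equal to ζ.
  refine ⟨(c * d)⁻¹, ?_, ?_⟩
  · rw [hη.mem_W_iff (by omega), pow_succ_apply', hcζ, map_smul, h0, smul_zero]
  · rw [mem_W_iff hpk.le, gSingle_sub, map_smul, gSingle_mirrorMap, ← hη.eq_gSingle, hcζ, map_smul,
      map_sub, map_smul, map_smul, hdζ, ← hζ, smul_smul, smul_smul, mul_assoc, inv_mul_cancel₀
      (mul_ne_zero hc hd), one_smul, sub_self]

end Mirror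

theorem iSupIndep_of_eigenvectors {E ι : Type*} [AddCommGroup E] [Module ℝ E] (T : E →ₗ[ℝ] E)
    {μ : ι → ℝ} (hμ : Function.Injective μ) {N : ι → Submodule ℝ E}
    (h : ∀ i, ∀ x ∈ N i, T x = μ i • x) : iSupIndep N :=
  ((Module.End.eigenspaces_iSupIndep T).comp hμ).mono fun i x hx =>
    Module.End.mem_eigenspace_iff.2 (h i x hx)

/-! ### Identification of the test space and directness of its sum. -/

section TestSpace

variable {n : ℕ} {σ : Finset (EuclideanSpace ℝ (Fin n))} {k ℓ p s : ℕ}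

theorem mem_testSummand (hsk : s < k) (hkℓ : k ≤ ℓ) {b : Field σ k ℓ} :
    b ∈ testSummand σ hsk.le hkℓ ↔ ∃ A ∈ traceFreeW σ (ℓ + s) (k - s) (ℓ - k + 2 * s + 1),
      constField σ k ℓ (mirrorMap (tangent σ) hsk.le hkℓ A) = b := by
  constructor
  · rintro ⟨f, hf, rfl⟩
    obtain ⟨A, hA, rfl⟩ := exists_constField_of_mem_bubbleW (by omega) (by omega) (by omega) hf
    exact ⟨A, hA, rfl⟩
  · rintro ⟨A, hA, rfl⟩
    exact ⟨_, constField_mem_bubbleW hA, rfl⟩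

theorem mirrorMap_mem_traceFreeW (hsp : s < p) (hpk : p ≤ k) (hkℓ : k ≤ ℓ)
    {A : Form (tangent σ) (ℓ + s) (k - s)}
    (hA : A ∈ traceFreeW σ (ℓ + s) (k - s) (ℓ - k + 2 * s + 1)) :
    mirrorMap (tangent σ) (hsp.le.trans hpk) hkℓ A ∈ traceFreeW σ k ℓ p := by
  rw [mem_traceFreeW] at hA ⊢
  refine ⟨mirrorMap_mem_W hsp hpk hkℓ hA.1, fun F h hF => ?_⟩
  rw [faceTrace, pullback_mirrorMap]
  change mirrorMap _ _ _ (faceTrace h.subset _ _ A) = 0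
  rw [hA.2 F h hF, map_zero]

/-- Induction on p, peeling off the component of index p - 1. That component is built from β by
operators commuting with pullback, so it stays trace-free. -/
theorem traceFreeW_le_of_mirrorMap_mem (hpk : p ≤ k) (hkℓ : k ≤ ℓ)
    {N : Submodule ℝ (Field σ k ℓ)}
    (hN : ∀ (s : ℕ) (hsp : s < p), ∀ A ∈ traceFreeW σ (ℓ + s) (k - s) (ℓ - k + 2 * s + 1),
      constField σ k ℓ (mirrorMap (tangent σ) (hsp.le.trans hpk) hkℓ A) ∈ N)
    {β : Form (tangent σ) k ℓ} (hβ : β ∈ traceFreeW σ k ℓ p) : constField σ k ℓ β ∈ N := by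
  induction p generalizing β with
  | zero =>
    have h : β = 0 := (mem_traceFreeW.1 hβ).1
    rw [h, map_zero]
    exact zero_mem N
  | succ p ih =>
    have hβ' := mem_traceFreeW.1 hβ
    obtain ⟨c, hA, hs⟩ := exists_sub_mirrorMap_mem_W hpk hkℓ hβ'.1
    set A := (gS ^ (ℓ - k + 2 * p)) ((gSd ^ p) (gSingle k ℓ β)) (ℓ + p) (k - p) with hAdef
    have hAt : A ∈ traceFreeW σ (ℓ + p) (k - p) (ℓ - k + 2 * p + 1) := by
      refine mem_traceFreeW.2 ⟨hA, fun F h hF => ?_⟩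
      rw [hAdef, faceTrace, ← gPull_apply, gPull_gS_pow, gPull_gSd_pow, gPull_gSingle]
      change ((gS ^ _) ((gSd ^ p) (gSingle k ℓ (faceTrace h.subset k ℓ β)))) _ _ = 0
      rw [hβ'.2 F h hF, map_zero, map_zero, map_zero]
      rfl
    have hm := mirrorMap_mem_traceFreeW (Nat.lt_succ_self p) hpk hkℓ hAt
    set m := mirrorMap (tangent σ) (Nat.le_of_lt hpk) hkℓ A
    have h1 : β - c • m ∈ traceFreeW σ k ℓ p := by
      refine mem_traceFreeW.2 ⟨hs, (mem_traceFreeW (p := p + 1).1 ?_).2⟩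
      exact Submodule.sub_mem (M := Form (tangent σ) k ℓ) (traceFreeW σ k ℓ (p + 1)) hβ
        (Submodule.smul_mem _ c hm)
    have h2 := ih (by omega) (fun s hsp => hN s (by omega)) h1
    have h3 := Submodule.smul_mem N c (hN p (by omega) A hAt)
    have h4 : constField σ k ℓ β = constField σ k ℓ (β - c • m) + c • constField σ k ℓ m :=
      funext fun x => (sub_add_cancel (G := Form (tangent σ) k ℓ) β (c • m)).symm
    rw [h4]
    exact N.add_mem h2 h3

/-- Unisolvence and conformity use the test space only through this description. -/
theorem testSpace_eq (hpk : p ≤ k) (hkℓ : k ≤ ℓ) :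
    testSpace σ hpk hkℓ = (traceFreeW σ k ℓ p).map (constField σ k ℓ) := by
  refine le_antisymm (iSup_le fun s b hb => ?_) ?_
  · obtain ⟨A, hA, rfl⟩ := (mem_testSummand (s.is_lt.trans_le hpk) hkℓ).1 hb
    exact ⟨_, mirrorMap_mem_traceFreeW s.is_lt hpk hkℓ hA, rfl⟩
  · rintro _ ⟨β, hβ, rfl⟩
    refine traceFreeW_le_of_mirrorMap_mem hpk hkℓ (fun s hsp A hA => ?_) hβ
    exact Submodule.mem_iSup_of_mem (⟨s, hsp⟩ : Fin p)
      ((mem_testSummand (hsp.trans_le hpk) hkℓ).2 ⟨A, hA, rfl⟩)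

theorem iSupIndep_testSummand (hpk : p ≤ k) (hkℓ : k ≤ ℓ) :
    iSupIndep fun s : Fin p => testSummand σ (s.is_lt.le.trans hpk) hkℓ := by
  let T : Field σ k ℓ →ₗ[ℝ] Field σ k ℓ :=
    (casimir (tangent σ) k ℓ).compLeft (EuclideanSpace ℝ (Fin n))
  let μ : Fin p → ℝ := fun s => (((s : ℕ) * (ℓ - k + s + 1) : ℕ) : ℝ)
  have hμ : Function.Injective μ := by
    have : StrictMono fun s : ℕ => s * (ℓ - k + s + 1) := by
      refine strictMono_nat_of_lt_succ fun s => ?_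
      nlinarith
    intro a b hab
    exact Fin.ext (this.injective (Nat.cast_injective hab))
  refine iSupIndep_of_eigenvectors (E := Field σ k ℓ) T hμ fun s b hb => ?_
  obtain ⟨A, hA, rfl⟩ := (mem_testSummand (s.is_lt.trans_le hpk) hkℓ).1 hb
  funext x
  exact casimir_mirrorMap (s.is_lt.trans_le hpk) hkℓ (mem_traceFreeW.1 hA).1

end TestSpace

/-! ### Extension of trace-free forms from a subsimplex to ℝⁿ. -/

section Extension

variable {n : ℕ}

theorem sum_proj_smul_single {ι : Type*} [Fintype ι] [DecidableEq ι] (x : ι → ℝ) :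
    ∑ i, (LinearMap.proj i : (ι → ℝ) →ₗ[ℝ] ℝ) x • (Pi.single i (1 : ℝ) : ι → ℝ) = x := by
  ext j
  simp [Finset.sum_apply, Pi.single_apply]

theorem sum_proj_single {ι : Type*} [Fintype ι] [DecidableEq ι] (i : ι) :
    (∑ j, (LinearMap.proj j : (ι → ℝ) →ₗ[ℝ] ℝ)) (Pi.single i (1 : ℝ)) = 1 := by
  simp [LinearMap.sum_apply, Pi.single_apply]

/-- The sum of the barycentric coordinates with respect to the vertices of `σ`. -/
def coordSum (σ : Finset (EuclideanSpace ℝ (Fin n))) : (σ → ℝ) →ₗ[ℝ] ℝ :=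
  ∑ i : σ, LinearMap.proj i

theorem coordSum_apply (σ : Finset (EuclideanSpace ℝ (Fin n))) (u : σ → ℝ) :
    coordSum σ u = ∑ i, u i := by
  simp [coordSum, LinearMap.sum_apply]

/-- The tangent vector with given barycentric coordinates. -/
def ofCoord (σ : Finset (EuclideanSpace ℝ (Fin n))) :
    LinearMap.ker (coordSum σ) →ₗ[ℝ] tangent σ :=
  LinearMap.codRestrict _
    (Fintype.linearCombination ℝ (fun i : σ => (i : EuclideanSpace ℝ (Fin n))) ∘ₗ
      (LinearMap.ker (coordSum σ)).subtype) fun u => by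
    have hu : ∑ i, (u : σ → ℝ) i = 0 := (coordSum_apply σ u).symm.trans u.2
    have h := weightedVSub_mem_vectorSpan (k := ℝ) (s := Finset.univ) hu
      (fun i : σ => (i : EuclideanSpace ℝ (Fin n)))
    rw [Finset.univ.weightedVSub_eq_linear_combination hu] at h
    have h2 : Set.range (fun i : σ => (i : EuclideanSpace ℝ (Fin n))) = σ := Subtype.range_coe
    rw [h2] at h
    exact h

theorem ofCoord_apply (σ : Finset (EuclideanSpace ℝ (Fin n))) (u : LinearMap.ker (coordSum σ)) :
    (ofCoord σ u : EuclideanSpace ℝ (Fin n)) =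
      ∑ i : σ, (u : σ → ℝ) i • (i : EuclideanSpace ℝ (Fin n)) := rfl

/-- The linear parts of the barycentric coordinates of an `n`-simplex. -/
theorem exists_coord {K : Finset (EuclideanSpace ℝ (Fin n))}
    (hK : AffineIndependent ℝ ((↑) : K → EuclideanSpace ℝ (Fin n))) (hc : K.card = n + 1) :
    ∃ c : EuclideanSpace ℝ (Fin n) → EuclideanSpace ℝ (Fin n) →ₗ[ℝ] ℝ,
      (∀ x, ∑ a ∈ K, c a x = 0) ∧ (∀ x, ∑ a ∈ K, c a x • a = x) ∧
      ∀ τ ⊆ K, ∀ x ∈ tangent τ, ∀ a, a ∉ τ → c a x = 0 := by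
  classical
  let B : AffineBasis K ℝ (EuclideanSpace ℝ (Fin n)) := ⟨(↑), hK, by
    rw [hK.affineSpan_eq_top_iff_card_eq_finrank_add_one]
    simpa using hc⟩
  have hB : ∀ i, B i = i := fun _ => rfl
  -- Extended by zero to points that are not vertices, so that sums over different faces can be
  -- compared directly.
  let c : EuclideanSpace ℝ (Fin n) → EuclideanSpace ℝ (Fin n) →ₗ[ℝ] ℝ :=
    fun a => if h : a ∈ K then (B.coord ⟨a, h⟩).linear else 0
  have hc : ∀ a : K, c a = (B.coord a).linear := fun a => dif_pos a.2
  have hcx : ∀ (a : K) x, c a x = B.coord a x - B.coord a 0 := fun a x => by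
    rw [hc, ← vsub_eq_sub (B.coord a x), ← AffineMap.linearMap_vsub, vsub_eq_sub, sub_zero]
  refine ⟨c, fun x => ?_, fun x => ?_, fun τ hτ x hx a ha => ?_⟩
  · rw [← Finset.sum_coe_sort]
    simp only [hcx, Finset.sum_sub_distrib, B.sum_coord_apply_eq_one, sub_self]
  · rw [← Finset.sum_coe_sort K fun a => c a x • a]
    simp only [hcx, sub_smul, Finset.sum_sub_distrib]
    have h := B.linear_combination_coord_eq_self
    simp only [hB] at h
    rw [h, h, sub_zero]
  · by_cases haK : a ∈ K
    · have h : tangent τ ≤ LinearMap.ker (c a) := by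
        refine Submodule.span_le.2 ?_
        rintro _ ⟨y, hy, z, hz, rfl⟩
        have hyz : ∀ y ∈ τ, B.coord ⟨a, haK⟩ y = 0 := fun y hy =>
          B.coord_apply_ne (i := ⟨a, haK⟩) (j := ⟨y, hτ hy⟩) fun h => by
            rw [Subtype.mk.injEq] at h
            exact ha (h ▸ hy)
        change c a (y -ᵥ z) = 0
        rw [hc ⟨a, haK⟩, AffineMap.linearMap_vsub, hyz y hy, hyz z hz, vsub_self]
      exact h hx
    · simp [c, haK]

theorem form_eq_zero_of_subsingleton {U : Type*} [AddCommGroup U] [Module ℝ U] [Subsingleton U]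
    {k ℓ : ℕ} (hk : 1 ≤ k) (ω : Form U k ℓ) : ω = 0 := by
  ext v u
  rw [ω.map_coord_zero (⟨0, hk⟩ : Fin k) (Subsingleton.elim _ _)]
  rfl

/-- A form on a coordinate space that restricts to a bubble and is annihilated by `diagOp` vanishes
on all proper coordinate subspaces. -/
theorem pullback_extend_eq_zero {σ ρ : Finset (EuclideanSpace ℝ (Fin n))} (hρ : ρ ⊂ σ)
    {k ℓ p : ℕ} (hp : p ≤ k) (hk : 1 ≤ k) (hℓ : 1 ≤ ℓ) {β : Form (tangent σ) k ℓ}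
    (hβ : β ∈ traceFreeW σ k ℓ p) {ω : Form (σ → ℝ) k ℓ} (hω : ω ∈ W (σ → ℝ) k ℓ p)
    (hωβ : pullback (LinearMap.ker (coordSum σ)).subtype k ℓ ω = pullback (ofCoord σ) k ℓ β)
    (hD : diagOp (fun i : σ => (LinearMap.proj i : (σ → ℝ) →ₗ[ℝ] ℝ))
      (fun i => Pi.single i (1 : ℝ)) (gSingle k ℓ ω) = 0) :
    pullback (Function.ExtendByZero.linearMap ℝ
      (Subtype.impEmbedding _ _ hρ.subset)) k ℓ ω = 0 := by
  classical
  obtain rfl | ⟨i₀, hi₀⟩ := ρ.eq_empty_or_nonempty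
  · exact form_eq_zero_of_subsingleton hk _
  set φ : ρ ↪ σ := Subtype.impEmbedding _ _ hρ.subset with hφ
  set j := Function.ExtendByZero.linearMap ℝ φ with hj
  have hj1 : ∀ (u : ρ → ℝ) (a : ρ), j u (φ a) = u a :=
    fun u a => φ.injective.extend_apply _ _ _
  have hj0 : ∀ (u : ρ → ℝ) (i : σ), i ∉ Set.range φ → j u i = 0 :=
    fun u i hi => Function.extend_apply' _ _ _ hi
  have hjker : ∀ u : LinearMap.ker (coordSum ρ), j u ∈ LinearMap.ker (coordSum σ) := fun u => by
    have hu : ∑ i, (u : ρ → ℝ) i = 0 := (coordSum_apply ρ u).symm.trans u.2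
    rw [LinearMap.mem_ker, coordSum_apply, ← hu]
    exact (Fintype.sum_of_injective φ φ.injective _ _ (hj0 u) fun a => (hj1 u a).symm).symm
  let j' : LinearMap.ker (coordSum ρ) →ₗ[ℝ] LinearMap.ker (coordSum σ) :=
    LinearMap.codRestrict _ (j ∘ₗ (LinearMap.ker (coordSum ρ)).subtype) hjker
  have hj' : ofCoord σ ∘ₗ j' =
      Submodule.inclusion (vectorSpan_mono ℝ (Finset.coe_subset.2 hρ.subset)) ∘ₗ ofCoord ρ := by
    refine LinearMap.ext fun u => Subtype.ext ?_
    change (ofCoord σ (j' u) : EuclideanSpace ℝ (Fin n)) = ofCoord ρ u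
    rw [ofCoord_apply, ofCoord_apply]
    refine (Fintype.sum_of_injective φ φ.injective _ _ (fun i hi => ?_) fun a => ?_).symm
    · change j u i • _ = _
      rw [hj0 u i hi, zero_smul]
    · change _ = j u (φ a) • _
      rw [hj1]
      rfl
  -- On the tangent space of ρ the form is the face trace of β, hence zero.
  have h0 : gPull (LinearMap.ker (coordSum ρ)).subtype (gPull j (gSingle k ℓ ω)) = 0 := by
    rw [gPull_gSingle, gPull_gSingle]
    have h1 : pullback (LinearMap.ker (coordSum ρ)).subtype k ℓ (pullback j k ℓ ω) =
        pullback j' k ℓ (pullback (LinearMap.ker (coordSum σ)).subtype k ℓ ω) := rfl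
    have h2 : pullback j' k ℓ (pullback (ofCoord σ) k ℓ β) =
        pullback (ofCoord σ ∘ₗ j') k ℓ β := rfl
    have h3 : pullback (ofCoord σ ∘ₗ j') k ℓ β =
        pullback (ofCoord ρ) k ℓ (faceTrace hρ.subset k ℓ β) := by rw [hj']; rfl
    rw [h1, hωβ, h2, h3, (mem_traceFreeW.1 hβ).2 ρ hρ ⟨i₀, hi₀⟩, map_zero, map_zero]
  have hW : (gSd ^ p) (gPull j (gSingle k ℓ ω)) = 0 := by
    rw [← gPull_gSd_pow, (mem_W_iff hp).1 hω, map_zero]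
  -- Injectivity of `diagOp` is now used on ℝ^ρ. Its vanishing there follows from naturality.
  have h := eq_zero_of_diagOp_eq_zero sum_proj_smul_single sum_proj_single ⟨i₀, hi₀⟩ hp hℓ
    ((isDeg_gSingle k ℓ ω).gPull j) hW h0 ?_
  · rw [gPull_gSingle] at h
    rw [← gSingle_same k ℓ (pullback j k ℓ ω), h]
    rfl
  · rw [← gPull_diagOp _ _ j φ (fun a => ?_) (fun a => ?_) (fun i hi => ?_), hD, map_zero]
    · ext i
      by_cases hi : i ∈ Set.range φ
      · obtain ⟨b, rfl⟩ := hi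
        rw [hj1]
        simp [Pi.single_apply, φ.injective.eq_iff]
      · rw [hj0 _ _ hi, Pi.single_eq_of_ne]
        rintro rfl
        exact hi ⟨a, rfl⟩
    · exact LinearMap.ext fun u => hj1 u a
    · exact LinearMap.ext fun u => hj0 u i hi

/-- Extension of bubbles: a form in `𝕎_{[p]}^{k,ℓ}(σ)` with vanishing traces on the proper
subsimplices is the trace of a form in `𝕎_{[p]}^{k,ℓ}(ℝⁿ)` with vanishing traces on all
subsimplices of `K` that do not contain `σ`. -/
theorem exists_trace_eq {K σ : Finset (EuclideanSpace ℝ (Fin n))}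
    (hK : AffineIndependent ℝ ((↑) : K → EuclideanSpace ℝ (Fin n))) (hc : K.card = n + 1)
    (hσ : σ ⊆ K) (hne : σ.Nonempty) {k ℓ p : ℕ} (hp : p ≤ k) (hkℓ : k ≤ ℓ)
    {β : Form (tangent σ) k ℓ} (hβ : β ∈ traceFreeW σ k ℓ p) :
    ∃ ω ∈ W (EuclideanSpace ℝ (Fin n)) k ℓ p, trace σ k ℓ ω = β ∧
      ∀ τ ⊆ K, ¬ σ ⊆ τ → trace τ k ℓ ω = 0 := by
  classical
  obtain rfl | hp0 := p.eq_zero_or_pos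
  · have h : β = 0 := (mem_traceFreeW.1 hβ).1
    exact ⟨0, zero_mem _, by rw [map_zero, h], fun τ _ _ => map_zero _⟩
  obtain ⟨i₀, hi₀⟩ := hne
  obtain ⟨c, hc0, hc1, hcτ⟩ := exists_coord hK hc
  -- Any linear projection of ℝ^σ onto ker s provides a first lift of β, which remains in 𝕎_{[p]}.
  obtain ⟨π, hπ⟩ := (LinearMap.ker (coordSum σ)).subtype.exists_leftInverse_of_injective
    (LinearMap.ker_eq_bot.2 (Submodule.injective_subtype _))
  have hβ' := pullback_mem_W (ofCoord σ ∘ₗ π) hp (mem_traceFreeW.1 hβ).1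
  obtain ⟨ω, hω, hωβ, hD⟩ := exists_lift_diagOp_eq_zero sum_proj_smul_single sum_proj_single
    (⟨i₀, hi₀⟩ : σ) hp (by omega : 1 ≤ ℓ) hβ'
  replace hωβ : pullback (LinearMap.ker (coordSum σ)).subtype k ℓ ω =
      pullback (ofCoord σ) k ℓ β := by
    have h1 : pullback (LinearMap.ker (coordSum σ)).subtype k ℓ
        (pullback (ofCoord σ ∘ₗ π) k ℓ β) =
        pullback (ofCoord σ ∘ₗ (π ∘ₗ (LinearMap.ker (coordSum σ)).subtype)) k ℓ β := rfl
    rw [hπ, LinearMap.comp_id] at h1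
    exact hωβ.trans h1
  let P : EuclideanSpace ℝ (Fin n) →ₗ[ℝ] (σ → ℝ) := LinearMap.pi fun i => c i
  refine ⟨pullback P k ℓ ω, pullback_mem_W P hp hω, ?_, fun τ hτ hστ => ?_⟩
  · have hPker : ∀ x : tangent σ, P x ∈ LinearMap.ker (coordSum σ) := fun x => by
      rw [LinearMap.mem_ker, coordSum_apply, ← hc0 x]
      change ∑ i : σ, c i x = _
      rw [Finset.sum_coe_sort σ fun a => c a x]
      exact Finset.sum_subset hσ fun a _ ha => hcτ σ hσ x x.2 a ha
    let P' : tangent σ →ₗ[ℝ] LinearMap.ker (coordSum σ) :=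
      LinearMap.codRestrict _ (P ∘ₗ (tangent σ).subtype) hPker
    have hP' : ofCoord σ ∘ₗ P' = LinearMap.id := by
      refine LinearMap.ext fun x => Subtype.ext ?_
      change (ofCoord σ (P' x) : EuclideanSpace ℝ (Fin n)) = x
      rw [ofCoord_apply]
      change ∑ i : σ, c i x • (i : EuclideanSpace ℝ (Fin n)) = x
      rw [Finset.sum_coe_sort σ fun a => c a x • a]
      conv_rhs => rw [← hc1 x]
      refine Finset.sum_subset hσ fun a _ ha => ?_
      rw [hcτ σ hσ x x.2 a ha, zero_smul]
    have h1 : trace σ k ℓ (pullback P k ℓ ω) =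
        pullback P' k ℓ (pullback (LinearMap.ker (coordSum σ)).subtype k ℓ ω) := rfl
    have h2 : pullback P' k ℓ (pullback (ofCoord σ) k ℓ β) = pullback (ofCoord σ ∘ₗ P') k ℓ β := rfl
    rw [h1, hωβ, h2, hP']
    rfl
  · have hρ : τ ∩ σ ⊂ σ := by
      refine Finset.ssubset_iff_subset_ne.2 ⟨Finset.inter_subset_right, fun h => hστ ?_⟩
      exact Finset.inter_eq_right.1 h
    -- Barycentric coordinates of vertices outside τ are constant on τ, so P restricted to T_τ
    -- factors through the proper coordinate subspace of τ ∩ σ.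
    let P' : tangent τ →ₗ[ℝ] ((τ ∩ σ : Finset (EuclideanSpace ℝ (Fin n))) → ℝ) :=
      LinearMap.pi (fun i => c i) ∘ₗ (tangent τ).subtype
    have hP' : P ∘ₗ (tangent τ).subtype =
        Function.ExtendByZero.linearMap ℝ (Subtype.impEmbedding _ _ hρ.subset) ∘ₗ P' := by
      refine LinearMap.ext fun x => funext fun i => ?_
      change c i x = Function.extend _ (P' x) (0 : σ → ℝ) i
      by_cases hi : (i : EuclideanSpace ℝ (Fin n)) ∈ τ
      · exact ((Subtype.impEmbedding _ _ hρ.subset).injective.extend_apply (P' x) _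
          (⟨i, Finset.mem_inter.2 ⟨hi, i.2⟩⟩ : (τ ∩ σ : Finset (EuclideanSpace ℝ (Fin n))))).symm
      · rw [hcτ τ hτ x x.2 i hi, Function.extend_apply']
        · rfl
        · rintro ⟨a, rfl⟩
          exact hi (Finset.mem_inter.1 a.2).1
    have h1 : trace τ k ℓ (pullback P k ℓ ω) = pullback (P ∘ₗ (tangent τ).subtype) k ℓ ω := rfl
    have h2 : ∀ g : ((τ ∩ σ : Finset (EuclideanSpace ℝ (Fin n))) → ℝ) →ₗ[ℝ] (σ → ℝ),
        pullback (g ∘ₗ P') k ℓ ω = pullback P' k ℓ (pullback g k ℓ ω) := fun _ => rfl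
    rw [h1, hP', h2, pullback_extend_eq_zero hρ hp (by omega) (by omega) hβ hω hωβ hD, map_zero]

end Extension

/-! ### Definiteness of the Frobenius inner product. -/

section Frobenius

variable {U : Type*} [NormedAddCommGroup U] [InnerProductSpace ℝ U] [FiniteDimensional ℝ U]
  {k ℓ : ℕ}

/-- The Frobenius inner product as a bilinear form. -/
def frobeniusBilin (U : Type*) [NormedAddCommGroup U] [InnerProductSpace ℝ U]
    [FiniteDimensional ℝ U] (k ℓ : ℕ) : Form U k ℓ →ₗ[ℝ] Form U k ℓ →ₗ[ℝ] ℝ :=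
  LinearMap.mk₂ ℝ frobenius
    (fun ω ω' η => by
      simp only [frobenius, AlternatingMap.add_apply, add_mul, Finset.sum_add_distrib, mul_add])
    (fun c ω η => by
      simp only [frobenius, AlternatingMap.smul_apply, smul_eq_mul, mul_assoc, Finset.mul_sum]
      simp only [mul_left_comm c])
    (fun ω η η' => by
      simp only [frobenius, AlternatingMap.add_apply, Finset.sum_add_distrib, mul_add])
    (fun c ω η => by
      simp only [frobenius, AlternatingMap.smul_apply, smul_eq_mul, Finset.mul_sum]
      simp only [mul_left_comm c])

theorem eq_zero_of_frobenius_self_eq_zero {ω : Form U k ℓ} (h : frobenius ω ω = 0) : ω = 0 := by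
  have h1 := (mul_eq_zero.1 h).resolve_left (by positivity)
  rw [Finset.sum_eq_zero_iff_of_nonneg
    fun _ _ => Finset.sum_nonneg fun _ _ => mul_self_nonneg _] at h1
  refine Module.Basis.ext_alternating (stdOrthonormalBasis ℝ U).toBasis fun I _ => ?_
  refine Module.Basis.ext_alternating (stdOrthonormalBasis ℝ U).toBasis fun J _ => ?_
  have h2 := h1 I (Finset.mem_univ I)
  rw [Finset.sum_eq_zero_iff_of_nonneg fun _ _ => mul_self_nonneg _] at h2
  simpa using mul_self_eq_zero.1 (h2 J (Finset.mem_univ J))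

end Frobenius

/-! ### Simplices have positive finite volume. -/

section Volume

variable {n : ℕ} {σ : Finset (EuclideanSpace ℝ (Fin n))}

/-- The parametrization of the affine hull of `σ` by its tangent space. -/
def tangentShift (σ : Finset (EuclideanSpace ℝ (Fin n))) (v : EuclideanSpace ℝ (Fin n)) :
    tangent σ →ᵃ[ℝ] EuclideanSpace ℝ (Fin n) where
  toFun t := t + v
  linear := (tangent σ).subtype
  map_vadd' p w := by simp [add_assoc]

/-- Translation identifies the simplex isometrically with a compact convex set spanning T_σ, which
therefore has nonempty interior there. -/
theorem euclideanHausdorffMeasure_convexHull (hσ : σ.Nonempty) :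
    0 < (μHE[Module.finrank ℝ (tangent σ)] : Measure (EuclideanSpace ℝ (Fin n))).real
      (convexHull ℝ (σ : Set (EuclideanSpace ℝ (Fin n)))) := by
  obtain ⟨v, hv⟩ := hσ
  set f := tangentShift σ v with hf
  have hinj : Function.Injective f := fun x y h => Subtype.ext (add_right_cancel h)
  have hiso : Isometry f := Isometry.of_dist_eq fun x y => by
    change dist ((x : EuclideanSpace ℝ (Fin n)) + v) (y + v) = _
    rw [dist_add_right]
    rfl
  set S : Set (tangent σ) := f ⁻¹' σ with hS
  have hfS : f '' S = σ := by
    refine Set.image_preimage_eq_of_subset fun x hx => ?_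
    exact ⟨⟨x - v, vsub_mem_vectorSpan ℝ hx hv⟩, sub_add_cancel x v⟩
  have hSfin : S.Finite := σ.finite_toSet.preimage hinj.injOn
  have hSne : S.Nonempty := ⟨0, by
    change (0 : EuclideanSpace ℝ (Fin n)) + v ∈ (σ : Set (EuclideanSpace ℝ (Fin n)))
    rwa [zero_add]⟩
  have hSspan : affineSpan ℝ S = ⊤ := by
    rw [AffineSubspace.affineSpan_eq_top_iff_vectorSpan_eq_top_of_nonempty ℝ _ _ hSne]
    refine Submodule.map_injective_of_injective (tangent σ).injective_subtype ?_
    rw [Submodule.map_subtype_top]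
    exact f.map_vectorSpan.trans (by rw [hfS])
  rw [← hfS, ← AffineMap.image_convexHull, Measure.real, hiso.euclideanHausdorffMeasure_image]
  refine ENNReal.toReal_pos ?_ (hSfin.isCompact_convexHull ℝ).measure_lt_top.ne
  exact (Measure.measure_pos_of_nonempty_interior _
    (interior_convexHull_nonempty_iff_affineSpan_eq_top.2 hSspan)).ne'

theorem dof_constField {k ℓ : ℕ} (ω : Form (EuclideanSpace ℝ (Fin n)) k ℓ)
    (β : Form (tangent σ) k ℓ) : dof σ ω (constField σ k ℓ β) =
      (μHE[Module.finrank ℝ (tangent σ)] : Measure (EuclideanSpace ℝ (Fin n))).real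
        (convexHull ℝ (σ : Set (EuclideanSpace ℝ (Fin n)))) * frobenius (trace σ k ℓ ω) β := by
  rw [← smul_eq_mul, ← setIntegral_const]
  rfl

end Volume

/-! ### Unisolvence and conformity. -/

section Unisolvence

/-- Riesz representation on a subspace: definiteness makes N → N* injective, and dimensions agree.
-/
theorem exists_mem_forall_bilin_eq {E : Type*} [AddCommGroup E] [Module ℝ E]
    [FiniteDimensional ℝ E] (B : E →ₗ[ℝ] E →ₗ[ℝ] ℝ) (hB : ∀ x, B x x = 0 → x = 0)
    (N : Submodule ℝ E) (φ : N →ₗ[ℝ] ℝ) : ∃ x ∈ N, ∀ y : N, B x y = φ y := by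
  let D : N →ₗ[ℝ] Module.Dual ℝ N := B.compl₁₂ N.subtype N.subtype
  have hD : Function.Injective D := by
    refine (injective_iff_map_eq_zero D).2 fun x hx => ?_
    exact Subtype.ext (hB x (LinearMap.congr_fun hx x))
  obtain ⟨x, hx⟩ := (LinearMap.injective_iff_surjective_of_finrank_eq_finrank
    (Subspace.dual_finrank_eq (K := ℝ) (V := N)).symm).1 hD φ
  exact ⟨x, x.2, fun y => LinearMap.congr_fun hx y⟩

variable {n : ℕ} {k ℓ p : ℕ} {K σ : Finset (EuclideanSpace ℝ (Fin n))}

theorem dof_sub {hpk : p ≤ k} {hkℓ : k ≤ ℓ} (ω η : Form (EuclideanSpace ℝ (Fin n)) k ℓ)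
    {b : Field σ k ℓ} (hb : b ∈ testSpace σ hpk hkℓ) :
    dof σ (ω - η) b = dof σ ω b - dof σ η b := by
  rw [testSpace_eq] at hb
  obtain ⟨β, -, rfl⟩ := hb
  have h : trace σ k ℓ (ω - η) = trace σ k ℓ ω - trace σ k ℓ η := rfl
  have h1 : frobenius (trace σ k ℓ ω - trace σ k ℓ η) β =
      frobenius (trace σ k ℓ ω) β - frobenius (trace σ k ℓ η) β :=
    LinearMap.map_sub₂ (M' := Form (tangent σ) k ℓ) (frobeniusBilin (tangent σ) k ℓ) _ _ β
  rw [dof_constField, dof_constField, dof_constField, h, h1, mul_sub]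

/-- A form in `𝕎_{[p]}` all of whose degrees of freedom on `σ` and its subsimplices vanish has
vanishing trace on `σ`. -/
theorem trace_eq_zero_of_dof_eq_zero (hpk : p ≤ k) (hkℓ : k ≤ ℓ)
    {ω : Form (EuclideanSpace ℝ (Fin n)) k ℓ} (hω : ω ∈ W (EuclideanSpace ℝ (Fin n)) k ℓ p)
    (hσ : σ.Nonempty)
    (h : ∀ τ ⊆ σ, τ.Nonempty → ∀ b ∈ testSpace τ hpk hkℓ, dof τ ω b = 0) :
    trace σ k ℓ ω = 0 := by
  induction σ using Finset.strongInduction with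
  | H σ ih =>
    have hmem : trace σ k ℓ ω ∈ traceFreeW σ k ℓ p := by
      refine mem_traceFreeW.2 ⟨pullback_mem_W _ hpk hω, fun F hF hne => ?_⟩
      exact ih F hF hne fun τ hτ => h τ (hτ.trans hF.subset)
    -- The trace is itself an admissible test function once the face traces vanish.
    have h1 := h σ subset_rfl hσ (constField σ k ℓ (trace σ k ℓ ω)) (by
      rw [testSpace_eq]
      exact ⟨_, hmem, rfl⟩)
    rw [dof_constField] at h1
    exact eq_zero_of_frobenius_self_eq_zero
      ((mul_eq_zero.1 h1).resolve_left (euclideanHausdorffMeasure_convexHull hσ).ne')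

theorem eq_zero_of_trace_eq_zero
    (hK : AffineIndependent ℝ ((↑) : K → EuclideanSpace ℝ (Fin n))) (hc : K.card = n + 1)
    {ω : Form (EuclideanSpace ℝ (Fin n)) k ℓ} (h : trace K k ℓ ω = 0) : ω = 0 := by
  have hT : ∀ x, x ∈ tangent K := fun x => by
    have h1 : vectorSpan ℝ (Set.range ((↑) : K → EuclideanSpace ℝ (Fin n))) = ⊤ :=
      hK.vectorSpan_eq_top_of_card_eq_finrank_add_one (by simpa using hc)
    rw [Subtype.range_coe] at h1
    exact (Submodule.eq_top_iff'.1 h1) x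
  ext v u
  exact congrArg (fun α : Form (tangent K) k ℓ => α (fun i => ⟨v i, hT _⟩) fun i => ⟨u i, hT _⟩) h

/-- The system is triangular: simplices are added by nondecreasing cardinality, and the extended
bubble that corrects the values on the new σ has zero trace on all earlier simplices. -/
theorem exists_dof_eq (hK : AffineIndependent ℝ ((↑) : K → EuclideanSpace ℝ (Fin n)))
    (hc : K.card = n + 1) (hpk : p ≤ k) (hkℓ : k ≤ ℓ)
    (L : (σ : Finset (EuclideanSpace ℝ (Fin n))) → Module.Dual ℝ (testSpace σ hpk hkℓ))
    (s : Finset (Finset (EuclideanSpace ℝ (Fin n)))) (hs : ∀ σ ∈ s, σ.Nonempty ∧ σ ⊆ K) :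
    ∃ ω ∈ W (EuclideanSpace ℝ (Fin n)) k ℓ p,
      ∀ σ ∈ s, ∀ b : testSpace σ hpk hkℓ, dof σ ω b = L σ b := by
  classical
  revert hs
  refine Finset.induction_on_max_value Finset.card s
    (fun _ => ⟨0, zero_mem _, by simp⟩) fun σ s hσs hmax ih hs => ?_
  obtain ⟨ω, hω, hωL⟩ := ih fun τ hτ => hs τ (Finset.mem_insert_of_mem hτ)
  obtain ⟨hσ, hσK⟩ := hs σ (Finset.mem_insert_self σ s)
  have hvol := euclideanHausdorffMeasure_convexHull hσ
  set c := (μHE[Module.finrank ℝ (tangent σ)] : Measure (EuclideanSpace ℝ (Fin n))).real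
    (convexHull ℝ (σ : Set (EuclideanSpace ℝ (Fin n)))) with hcdef
  have hmem : ∀ γ ∈ traceFreeW σ k ℓ p, constField σ k ℓ γ ∈ testSpace σ hpk hkℓ := fun γ hγ => by
    rw [testSpace_eq]
    exact ⟨γ, hγ, rfl⟩
  -- The residual on σ, divided by the volume that relates degrees of freedom to Frobenius products.
  let φ : traceFreeW σ k ℓ p →ₗ[ℝ] ℝ :=
    c⁻¹ • (L σ ∘ₗ (constField σ k ℓ).restrict hmem) -
      frobeniusBilin (tangent σ) k ℓ (trace σ k ℓ ω) ∘ₗ (traceFreeW σ k ℓ p).subtype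
  have : FiniteDimensional ℝ (Form (tangent σ) k ℓ) := finiteDimensional_form k ℓ
  obtain ⟨β, hβ, hβφ⟩ := exists_mem_forall_bilin_eq (E := Form (tangent σ) k ℓ)
    (frobeniusBilin (tangent σ) k ℓ) (fun _ => eq_zero_of_frobenius_self_eq_zero)
    (traceFreeW σ k ℓ p) φ
  obtain ⟨η, hη, hηβ, hη0⟩ := exists_trace_eq hK hc hσK hσ hpk hkℓ hβ
  refine ⟨ω + η, add_mem hω hη, fun τ hτ b => ?_⟩
  obtain ⟨b, hb⟩ := b
  have hb' := hb
  rw [testSpace_eq] at hb'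
  obtain ⟨γ, hγ, rfl⟩ := hb'
  have htr : trace τ k ℓ (ω + η) = trace τ k ℓ ω + trace τ k ℓ η := rfl
  obtain rfl | hτs := Finset.mem_insert.1 hτ
  · have h1 : frobenius (trace τ k ℓ ω + β) γ = frobenius (trace τ k ℓ ω) γ + frobenius β γ :=
      LinearMap.map_add₂ (M := Form (tangent τ) k ℓ) (frobeniusBilin (tangent τ) k ℓ) _ _ γ
    have h2 : frobenius β γ = c⁻¹ * L τ ⟨constField τ k ℓ γ, hb⟩ - frobenius (trace τ k ℓ ω) γ :=
      hβφ ⟨γ, hγ⟩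
    rw [dof_constField, ← hcdef, htr, hηβ, h1, h2, add_sub_cancel, mul_inv_cancel_left₀ hvol.ne']
  · rw [← hωL τ hτs ⟨_, hb⟩, dof_constField, dof_constField, htr,
      hη0 τ (hs τ hτ).2 fun hστ => hσs ?_]
    · congr 2
      exact add_zero (M := Form (tangent τ) k ℓ) _
    -- An earlier τ containing σ has at most as many vertices, so it would equal σ, which is new.
    · rwa [Finset.eq_of_subset_of_card_le hστ (hmax τ hτs)]

theorem isUnisolvent_testSpace
    (hK : AffineIndependent ℝ ((↑) : K → EuclideanSpace ℝ (Fin n))) (hc : K.card = n + 1)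
    (hpk : p ≤ k) (hkℓ : k ≤ ℓ) :
    IsUnisolvent K (W (EuclideanSpace ℝ (Fin n)) k ℓ p) fun σ => testSpace σ hpk hkℓ := by
  classical
  intro L
  obtain ⟨ω, hω, hωL⟩ := exists_dof_eq hK hc hpk hkℓ L (K.powerset.filter Finset.Nonempty)
    fun σ hσ => by
      rw [Finset.mem_filter, Finset.mem_powerset] at hσ
      exact hσ.symm
  have hωL' : ∀ σ : Finset (EuclideanSpace ℝ (Fin n)), σ.Nonempty → σ ⊆ K →
      ∀ b : testSpace σ hpk hkℓ, dof σ ω b = L σ b := fun σ hσ hσK =>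
    hωL σ (Finset.mem_filter.2 ⟨Finset.mem_powerset.2 hσK, hσ⟩)
  refine ⟨ω, ⟨hω, hωL'⟩, fun η hη => ?_⟩
  refine Form.sub_eq_zero.1 (eq_zero_of_trace_eq_zero hK hc ?_)
  refine trace_eq_zero_of_dof_eq_zero hpk hkℓ
    (Submodule.sub_mem (M := Form (EuclideanSpace ℝ (Fin n)) k ℓ) _ hη.1 hω)
    (Finset.card_pos.1 (by omega)) fun τ hτ hne b hb => ?_
  rw [dof_sub _ _ hb, hη.2 τ hne hτ ⟨b, hb⟩, hωL' τ hne hτ ⟨b, hb⟩, sub_self]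

/-- On σ and all its faces, u_K - u_K' has zero degrees of freedom, so its trace on σ vanishes. -/
theorem isConforming_of_mem_feSpace (hpk : p ≤ k) (hkℓ : k ≤ ℓ)
    (T : Geometry.SimplicialComplex ℝ (EuclideanSpace ℝ (Fin n)))
    {u : Cell T → Form (EuclideanSpace ℝ (Fin n)) k ℓ}
    (hu : u ∈ feSpace T (W (EuclideanSpace ℝ (Fin n)) k ℓ p) fun σ => testSpace σ hpk hkℓ) :
    IsConforming T u := by
  intro σ hσ K K' hK hK'
  refine Form.sub_eq_zero.1 ?_
  change trace σ k ℓ (u K - u K') = 0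
  refine trace_eq_zero_of_dof_eq_zero hpk hkℓ
    (Submodule.sub_mem (M := Form (EuclideanSpace ℝ (Fin n)) k ℓ) _ (hu.1 K) (hu.1 K'))
    (T.nonempty_of_mem_faces hσ) fun τ hτ hne b hb => ?_
  rw [dof_sub _ _ hb, sub_eq_zero]
  exact hu.2 τ (T.down_closed hσ hτ hne) K K' (hτ.trans hK) (hτ.trans hK') b hb

end Unisolvence

end FormValued

end

theorem mainTheorem7 {n k ℓ p : ℕ} (hpk : p ≤ k) (hkℓ : k ≤ ℓ) (hℓn : ℓ + p ≤ n) :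
    (∀ K : Finset (EuclideanSpace ℝ (Fin n)),
      AffineIndependent ℝ ((↑) : K → EuclideanSpace ℝ (Fin n)) → K.card = n + 1 →
        (∀ σ : Finset (EuclideanSpace ℝ (Fin n)), σ.Nonempty → σ ⊆ K →
          iSupIndep (fun s : Fin p =>
            FormValued.testSummand σ (s.is_lt.le.trans hpk) hkℓ)) ∧
        FormValued.IsUnisolvent K (FormValued.W (EuclideanSpace ℝ (Fin n)) k ℓ p)
          (fun σ => FormValued.testSpace σ hpk hkℓ)) ∧
    (∀ T : Geometry.SimplicialComplex ℝ (EuclideanSpace ℝ (Fin n)),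
      ∀ u ∈ FormValued.feSpace T (FormValued.W (EuclideanSpace ℝ (Fin n)) k ℓ p)
          (fun σ => FormValued.testSpace σ hpk hkℓ),
        FormValued.IsConforming T u) :=
  ⟨fun _ hK hc => ⟨fun _ _ _ => FormValued.iSupIndep_testSummand hpk hkℓ,
    FormValued.isUnisolvent_testSpace hK hc hpk hkℓ⟩,
    fun T _ hu => FormValued.isConforming_of_mem_feSpace hpk hkℓ T hu⟩
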